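/- **Setting.** Let $(Z_t)_{t\in\mathbb Z}$ be a stationary ergodic sequence of random vectors in $\mathbb R^k$ with $\mathcal F_t=\sigma(Z_t,Z_{t-1},\dots)$. Let $h$ be an injective map from a set of real $k\times k$ matrices into a separable metric space $(F,d)$, and let $H$ be its image. Let $p\ge 1$, $q\ge0$ be integers. Let $E=H^p$ carry a complete metric, also denoted $d$, which induces the product topology and for which the coordinate projections $E\to H$ are Lipschitz. Let $\Theta$ be a subset of a metric parameter space, which also contains $\theta_0$. For $\Lambda(f)=\sup_{x\ne y}d(f(x),f(y))/d(x,y)$, a function $f(x,y)$ satisfies (CL) if $\Lambda(f(\cdot,y))\le\Lambda_f(y)$ for all $y$, for some continuous $\Lambda_f\ge0$. For random $u_t\in[0,\infty]$, $u_t\xrightarrow{\rm e.a.s.}0$ means that for some constant $C>0$, almost surely $u_t=o(e^{-Ct})$ as $t\to\infty$. **(ST).** There are processes $(X_t)$, $(\Sigma_t)$ with $X_t=\Sigma_t^{1/2}Z_t$ and $(h(\Sigma_k))_{k\le t}=\psi_t((h(\Sigma_k))_{k\le t-1},\theta_0)$ for all $t\in\mathbb Z$, where $\psi_t(\cdot,\theta_0)$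 is $\mathcal F_{t-1}$-measurable. The process $(X_t)$ is stationary, ergodic and non-anticipative ($X_t$ is $\mathcal F_t$-measurable), with $\mathbb E[\log^+\|X_0\|]<\infty$. Moreover, for all $t$, $(h(\Sigma_k))_{t-p+1\le k\le t}=\phi_t((h(\Sigma_k))_{t-p\le k\le t-1},\theta_0)$, where $$\phi_t((x_1,\dots,x_p),\theta)=(x_2,\dots,x_p,f(x_1,\dots,x_p;\theta;X_{t-1},\dots,X_{t-q}))$$ with $f$ an $H$-valued function that is measurable in $(x,X_{t-1},\dots,X_{t-q})$ for each $\theta$. **(CI).** $\Theta$ is compact. For all $t$, almost surely, $\theta\mapsto\phi_t(x,\theta)$ is continuous on $\Theta$ for every $x\in E$, and $\phi_t$ satisfies (CL) on $E\times\Theta$ with a stationary process $(\Lambda_{\phi_t})$ of Lipschitz coefficients. There is an integer $r\ge1$ such that the iterates $\phi_t^{(r)}(\cdot,\theta)=\phi_t(\cdot,\theta)\circ\cdots\circ\phi_{t-r+1}(\cdot,\theta)$ satisfy (CL), almost surely, with a stationary process $(\Lambda^{(r)}_{\phi_t})$ such that $\mathbb E[\log\Lambda^{(r)}_{\phi_0}(\theta)]<0$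 (possibly $-\infty$) for every $\theta\in\Theta$ and $\mathbb E[\sup_{\Theta}\log^+\Lambda^{(r)}_{\phi_0}(\theta)]<\infty$. Finally $\mathbb E[\sup_\Theta\log^+d(\phi_0(y,\theta),y)]<\infty$ for some $y\in E$. **Theorem.** Assume (ST) and (CI). Then the model is continuously invertible on $\Theta$. Namely, there are random functions $g_t:\Theta\to H$, $t\in\mathbb Z$, with the following properties. 1. For each $\theta\in\Theta$ the SRE $$(g_k(\theta))_{t-p+1\le k\le t}=\phi_t((g_k(\theta))_{t-p\le k\le t-1},\theta),\quad t\in\mathbb Z,$$ is convergent, and its unique stationary solution is $Y_t(\theta)=(g_k(\theta))_{t-p+1\le k\le t}$. That is, $(Y_t(\theta))_t$ is a stationary ergodic solution; every stationary solution equals it almost surely; $Y_t(\theta)=\lim_{m\to\infty}\phi_t(\cdot,\theta)\circ\cdots\circ\phi_{t-m}(\cdot,\theta)(y)$ a.s. for every $y\in E$ and $t\in\mathbb Z$; $Y_t(\theta)$ is, up to a null set, $\sigma(\phi_s(x,\theta):s\le t,\ x\in E)$-measurable; and $d(\tilde Y_t,Y_t(\theta))\xrightarrow{\rm e.a.s.}0$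 for every $(\tilde Y_t)$ with $\tilde Y_t=\phi_t(\tilde Y_{t-1},\theta)$ a.s. for all $t\ge1$. 2. Almost surely, for all $t\in\mathbb Z$, $g_t(\cdot)$ is continuous on $\Theta$, and the SRE in 1 holds for all $t\in\mathbb Z$ and $\theta\in\Theta$ simultaneously. 3. For each $\theta\in\Theta$ there is $\epsilon>0$ such that every family of random functions $\hat g_t:\Theta\to H$ which almost surely satisfies $$(\hat g_k(\theta'))_{t-p+1\le k\le t}=\phi_t((\hat g_k(\theta'))_{t-p\le k\le t-1},\theta'),\qquad t\ge1,\ \theta'\in\Theta,$$ and whose initial values $\theta'\mapsto(\hat g_k(\theta'))_{1-p\le k\le0}\in E$ are almost surely bounded on $\Theta$, satisfies $$\sup_{\theta'\in\overline B(\theta,\epsilon)\cap\Theta}d(\hat g_t(\theta'),g_t(\theta'))\xrightarrow{\rm e.a.s.}0,$$ and the same holds with $d(\hat g_t(\theta'),g_t(\theta'))$ replaced by the distance in $E$ of the blocks $(\hat g_k(\theta'))_{t-p+1\le k\le t}$ and $(g_k(\theta'))_{t-p+1\le k\le t}$. -/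

import Mathlib

open MeasureTheory Filter Topology
open scoped NNReal ENNReal

/-! ### Processes indexed by `ℤ` -/

section Processes

variable {Ω S : Type*} [MeasurableSpace Ω] [MeasurableSpace S]

/-- The left shift on two-sided sequences. -/
def seqShift (S : Type*) (x : ℤ → S) : ℤ → S := fun t => x (t + 1)

/-- `Y` is a (strictly) stationary process: its law on path space is shift invariant. -/
def IsStationaryProcess (μ : Measure Ω) (Y : ℤ → Ω → S) : Prop :=
  (∀ t, Measurable (Y t)) ∧
    MeasurePreserving (seqShift S) (μ.map fun ω t => Y t ω) (μ.map fun ω t => Y t ω)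

/-- `Y` is a stationary ergodic process: the shift is ergodic (in particular measure preserving)
for the law of `Y` on path space. -/
def IsStationaryErgodicProcess (μ : Measure Ω) (Y : ℤ → Ω → S) : Prop :=
  (∀ t, Measurable (Y t)) ∧ Ergodic (seqShift S) (μ.map fun ω t => Y t ω)

/-- The σ-algebra generated by `Y t, Y (t - 1), …`. -/
@[reducible] def pastSigmaAlgebra (Y : ℤ → Ω → S) (t : ℤ) : MeasurableSpace Ω :=
  ⨆ (s : ℤ) (_ : s ≤ t), MeasurableSpace.comap (Y s) inferInstance

/-- Exponential almost sure convergence to `0`: `u t = o(e^{-Ct})` almost surely as `t → ∞`,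
for some (deterministic) `C > 0`. -/
def ExpAlmostSurely (μ : Measure Ω) (u : ℤ → Ω → ℝ≥0∞) : Prop :=
  ∃ C : ℝ, 0 < C ∧ ∀ᵐ ω ∂μ,
    Tendsto (fun t : ℤ => ENNReal.ofReal (Real.exp (C * t)) * u t ω) atTop (𝓝 0)

/-- The positive part `log⁺ a` of the logarithm. -/
noncomputable def logPlus (a : ℝ≥0∞) : ℝ≥0∞ := (ENNReal.log a).toENNReal

/-- The negative part `log⁻ a` of the logarithm, with `log⁻ 0 = ∞`. -/
noncomputable def logMinus (a : ℝ≥0∞) : ℝ≥0∞ := (-ENNReal.log a).toENNReal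

/-- `E[log a]` is well defined in `[-∞, 0)`, i.e. `E[log⁺ a] < E[log⁻ a]`; the value `-∞` is
allowed and `log 0 = -∞`. -/
def NegativeLogMean (μ : Measure Ω) (a : Ω → ℝ≥0) : Prop :=
  ∫⁻ ω, logPlus (a ω) ∂μ < ∫⁻ ω, logMinus (a ω) ∂μ

end Processes

/-! ### Stochastic recurrence equations -/

section SRE

variable {Ω E : Type*}

/-- `backIter Ψ ω n t = Ψ_t ∘ Ψ_{t-1} ∘ ⋯ ∘ Ψ_{t-n+1}` (a composition of `n` maps). -/
def backIter (Ψ : ℤ → Ω → E → E) (ω : Ω) : ℕ → ℤ → E → E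
  | 0, _, x => x
  | n + 1, t, x => Ψ t ω (backIter Ψ ω n (t - 1) x)

/-- The σ-algebra generated by the random maps `Ψ_t, Ψ_{t-1}, …`. -/
@[reducible] def mapsSigmaAlgebra [MeasurableSpace E] (Ψ : ℤ → Ω → E → E) (t : ℤ) : MeasurableSpace Ω :=
  ⨆ (s : ℤ) (_ : s ≤ t) (x : E), MeasurableSpace.comap (fun ω => Ψ s ω x) inferInstance

variable [MeasurableSpace Ω] [MetricSpace E] [MeasurableSpace E]

/-- The recurrence `Y_t = Ψ_t(Y_{t-1})`, `t ∈ ℤ`, is convergent, and `Y` is its unique stationary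
solution: `Y` is stationary and ergodic, is the almost sure limit of the backward iterations from
any starting point, is a function of the past maps, and attracts all the solutions of the
recurrence for `t ≥ 1` exponentially fast almost surely. -/
structure IsConvergentSRE (μ : Measure Ω) (Ψ : ℤ → Ω → E → E) (Y : ℤ → Ω → E) : Prop where
  stationary_ergodic : IsStationaryErgodicProcess μ Y
  solution : ∀ᵐ ω ∂μ, ∀ t, Y t ω = Ψ t ω (Y (t - 1) ω)
  unique : ∀ Y' : ℤ → Ω → E, IsStationaryProcess μ Y' →
    (∀ᵐ ω ∂μ, ∀ t, Y' t ω = Ψ t ω (Y' (t - 1) ω)) → ∀ᵐ ω ∂μ, ∀ t, Y' t ω = Y t ω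
  limit : ∀ (y : E) (t : ℤ), ∀ᵐ ω ∂μ,
    Tendsto (fun m : ℕ => backIter Ψ ω (m + 1) t y) atTop (𝓝 (Y t ω))
  causal : ∀ t, AEStronglyMeasurable[mapsSigmaAlgebra Ψ t] (Y t) μ
  attracts : ∀ Y' : ℤ → Ω → E, (∀ᵐ ω ∂μ, ∀ t : ℤ, 1 ≤ t → Y' t ω = Ψ t ω (Y' (t - 1) ω)) →
    ExpAlmostSurely μ fun t ω => edist (Y' t ω) (Y t ω)

/-- Condition (CL) for `f : 𝒳 × 𝒴 → 𝒵`, with continuous Lipschitz coefficient `Λ : 𝒴 → ℝ⁺`. -/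
def SatisfiesCL {𝒳 𝒴 𝒵 : Type*} [MetricSpace 𝒳] [MetricSpace 𝒴] [MetricSpace 𝒵]
    (f : 𝒳 → 𝒴 → 𝒵) (Λ : 𝒴 → ℝ≥0) : Prop :=
  Continuous Λ ∧ ∀ y, LipschitzWith (Λ y) fun x => f x y

end SRE

/-! ### The general volatility model -/

/-- The ingredients of the general volatility model in dimension `k`, whose recurrence in terms
of the observations involves `p` lags of the transformed volatility and `q` past observations. -/
structure VolatilityModel {Ω : Type*} [MeasurableSpace Ω] (μ : Measure Ω) (k p q : ℕ)
    (F P : Type*) [MetricSpace F] [MeasurableSpace F] where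
  /-- the innovations -/
  Z : ℤ → Ω → (Fin k → ℝ)
  innovations : IsStationaryErgodicProcess μ Z
  /-- the set of admissible volatility matrices -/
  D : Set (Matrix (Fin k) (Fin k) ℝ)
  /-- the transformation of the volatility (its inverse is the link function) -/
  h : Matrix (Fin k) (Fin k) ℝ → F
  h_injective : Set.InjOn h D
  /-- the true parameter -/
  θ₀ : P
  /-- the random functions of the recurrence driven by the innovations; the sequence
  `(x_t, x_{t-1}, …)` is written `j ↦ x_{t-j}` -/
  ψ : ℤ → Ω → (ℕ → h '' D) → P → (ℕ → h '' D)
  ψ_adapted : ∀ (t : ℤ) (x : ℕ → h '' D),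
    Measurable[pastSigmaAlgebra Z (t - 1)] fun ω => ψ t ω x θ₀
  /-- the next transformed volatility, as a function of the `p` last ones `x_{t-p}, …, x_{t-1}`,
  of the parameter, and of the `q` last observations `X_{t-1}, …, X_{t-q}` -/
  f : (Fin p → h '' D) → P → (Fin q → (Fin k → ℝ)) → h '' D
  f_measurable : ∀ θ : P,
    Measurable fun z : (Fin p → h '' D) × (Fin q → (Fin k → ℝ)) => f z.1 θ z.2

namespace VolatilityModel

variable {Ω : Type*} [MeasurableSpace Ω] {μ : Measure Ω} {k p q : ℕ}
  {F P : Type*} [MetricSpace F] [MeasurableSpace F]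

/-- The image of `h`. -/
abbrev H (M : VolatilityModel μ k p q F P) : Type _ := M.h '' M.D

/-- The block `(g_{t-p+1}, …, g_t)`. -/
def block {H : Type*} (p : ℕ) (g : ℤ → H) (t : ℤ) : Fin p → H :=
  fun i => g (t - p + 1 + (i : ℕ))

/-- `(x_1, …, x_p), v ↦ (x_2, …, x_p, v)`. -/
def pushBlock {H : Type*} {p : ℕ} (x : Fin p → H) (v : H) : Fin p → H :=
  fun i => if hi : (i : ℕ) + 1 < p then x ⟨i + 1, hi⟩ else v

/-- The transformed volatility `h(Σ_t)`. -/
def transformed (M : VolatilityModel μ k p q F P) (Sig : ℤ → Ω → M.D) (ω : Ω) (t : ℤ) : M.H :=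
  ⟨M.h (Sig t ω), Set.mem_image_of_mem M.h (Sig t ω).2⟩

/-- The next transformed volatility when the observations are `X`. -/
def next (M : VolatilityModel μ k p q F P) (X : ℤ → Ω → (Fin k → ℝ)) (t : ℤ) (ω : Ω)
    (x : Fin p → M.H) (θ : P) : M.H :=
  M.f x θ fun i => X (t - 1 - (i : ℕ)) ω

/-- Condition (ST): `X` is a solution of the model with volatilities `Sig`, and is stationary,
non anticipative and ergodic, with finite logarithmic moments. -/
structure ST (M : VolatilityModel μ k p q F P) (Sig : ℤ → Ω → M.D)
    (X : ℤ → Ω → (Fin k → ℝ)) : Prop where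
  measurable_volatility : ∀ t i j,
    Measurable fun ω => (Sig t ω : Matrix (Fin k) (Fin k) ℝ) i j
  /-- `X_t = Σ_t^{1/2} Z_t`, with the positive semidefinite square root -/
  observation : ∀ᵐ ω ∂μ, ∀ t, ∃ R : Matrix (Fin k) (Fin k) ℝ,
    R.PosSemidef ∧ R * R = (Sig t ω : Matrix (Fin k) (Fin k) ℝ) ∧ X t ω = R.mulVec (M.Z t ω)
  /-- the recurrence driven by the innovations -/
  innovation_sre : ∀ᵐ ω ∂μ, ∀ t : ℤ, (fun j : ℕ => M.transformed Sig ω (t - j)) =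
    M.ψ t ω (fun j : ℕ => M.transformed Sig ω (t - 1 - j)) M.θ₀
  /-- the recurrence driven by the observations -/
  observation_sre : ∀ᵐ ω ∂μ, ∀ t : ℤ, M.transformed Sig ω t =
    M.next X t ω (block p (M.transformed Sig ω) (t - 1)) M.θ₀
  stationary_ergodic : IsStationaryErgodicProcess μ X
  nonanticipative : ∀ t, AEStronglyMeasurable[pastSigmaAlgebra M.Z t] (X t) μ
  log_moment : ∫⁻ ω, logPlus ‖X 0 ω‖ₑ ∂μ < ∞

variable {E : Type*} [MetricSpace E]

/-- The random map `φ_t(·, θ) : E → E` of the recurrence driven by the observations. The metric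
space `E` is the product of `p` copies of the image of `h`, with a metric of one's choice: `e`
identifies `E` with the product. -/
def φ (M : VolatilityModel μ k p q F P) (e : E ≃ₜ (Fin p → M.H)) (X : ℤ → Ω → (Fin k → ℝ))
    (θ : P) (t : ℤ) (ω : Ω) (x : E) : E :=
  e.symm (pushBlock (e x) (M.next X t ω (e x) θ))

/-- The block `(g_{t-p+1}, …, g_t)` as a point of `E`. -/
def state (M : VolatilityModel μ k p q F P) (e : E ≃ₜ (Fin p → M.H)) (g : ℤ → M.H) (t : ℤ) : E :=
  e.symm (block p g t)

/-- Condition (CI) on the compact set `Θ`: (CL) for `φ_t` and for its iterate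
`φ_t^{(r)} = φ_t ∘ ⋯ ∘ φ_{t-r+1}` with stationary continuous Lipschitz coefficients, a negative
Lyapunov coefficient at each point of `Θ`, and logarithmic moments. The functions `φ_t(x, ·)` are
continuous on `Θ`. -/
structure CI (M : VolatilityModel μ k p q F P) (e : E ≃ₜ (Fin p → M.H))
    (X : ℤ → Ω → (Fin k → ℝ)) (Θ : Set P) [MetricSpace P] : Prop where
  compact : IsCompact Θ
  continuous_param : ∀ t, ∀ᵐ ω ∂μ, ∀ x : E, Continuous fun θ : Θ => M.φ e X θ t ω x
  cl : ∃ Λ : ℤ → Ω → Θ → ℝ≥0, IsStationaryProcess μ Λ ∧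
    ∀ t, ∀ᵐ ω ∂μ, SatisfiesCL (fun (x : E) (θ : Θ) => M.φ e X θ t ω x) (Λ t ω)
  lyapunov : ∃ r : ℕ, 0 < r ∧ ∃ Λr : ℤ → Ω → Θ → ℝ≥0, IsStationaryProcess μ Λr ∧
    (∀ t, ∀ᵐ ω ∂μ,
      SatisfiesCL (fun (x : E) (θ : Θ) => backIter (M.φ e X (θ : P)) ω r t x) (Λr t ω)) ∧
    (∀ θ : Θ, NegativeLogMean μ fun ω => Λr 0 ω θ) ∧
    ∫⁻ ω, ⨆ θ : Θ, logPlus (Λr 0 ω θ) ∂μ < ∞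
  log_moment : ∃ y : E, ∫⁻ ω, ⨆ θ : Θ, logPlus (edist (M.φ e X θ 0 ω y) y) ∂μ < ∞

end VolatilityModel

/-! Near each parameter the random maps contract on average over blocks of length `r`. The
logarithmic mean of the supremum of the coefficient over a small ball tends to its value at the
centre, so it stays negative on some ball (`exists_closedBall_negativeLogMean`).

The ergodic theorem must turn this into exponential contraction, forward along solutions and
backward along iterates. There are two obstacles: the `r`-th power of an ergodic shift need not be
ergodic, and the one-step coefficients are only finite, with no logarithmic moment. Both are
overcome in `ae_eventually_le_exp_of_ergodic`. A product over `r` consecutive times is governed by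
an ergodic sum over all times, so each window contains one small term. At good times, when the
one-step coefficients are bounded over a window, smallness spreads to the neighbouring terms. Good
times have positive frequency, and the expansion since the last one is subexponential.

Ergodicity is known for the observations only. The coefficients are therefore replaced by
functionals of the observation path, suprema over countable dense sets (`dilation`), which the given
coefficients dominate. This yields `exists_ae_isContracting`.

The rest is deterministic for each outcome, up to recurrence. Backward iterates are uniformly Cauchy
on the ball because their increments combine exponential contraction with subexponential growth.
Their limit is a solution, continuous in the parameter. Stationary processes return to bounded sets,
which gives uniqueness, and forward contraction gives the attraction of all solutions. -/

/-! ### One-sided bounds for ergodic sums -/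

section ErgodicSums

variable {Ξ : Type*} {T : Ξ → Ξ} {g : Ξ → ℝ}

/-- The running maximum `max_{k ≤ n} S_k g` of the ergodic sums. -/
noncomputable def birkhoffMax (T : Ξ → Ξ) (g : Ξ → ℝ) : ℕ → Ξ → ℝ
  | 0, _ => 0
  | n + 1, ξ => max 0 (g ξ + birkhoffMax T g n (T ξ))

theorem birkhoffMax_nonneg (n : ℕ) (ξ : Ξ) : 0 ≤ birkhoffMax T g n ξ := by
  cases n with
  | zero => exact le_rfl
  | succ n => exact le_max_left _ _

theorem birkhoffMax_le_succ (n : ℕ) : ∀ ξ, birkhoffMax T g n ξ ≤ birkhoffMax T g (n + 1) ξ := by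
  induction n with
  | zero => exact fun ξ => birkhoffMax_nonneg _ ξ
  | succ n ih => exact fun ξ => max_le_max le_rfl (by gcongr; exact ih (T ξ))

theorem birkhoffSum_le_birkhoffMax (n : ℕ) :
    ∀ ξ, birkhoffSum T g n ξ ≤ birkhoffMax T g n ξ := by
  induction n with
  | zero => exact fun ξ => by simp [birkhoffMax]
  | succ n ih =>
    intro ξ
    rw [birkhoffSum_succ']
    exact le_max_of_le_right (by gcongr; exact ih (T ξ))

theorem birkhoffSum_sub_const (c : ℝ) (n : ℕ) (ξ : Ξ) :
    birkhoffSum T (fun ξ => g ξ - c) n ξ = birkhoffSum T g n ξ - n * c := by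
  simp [birkhoffSum, Finset.sum_sub_distrib]

variable [MeasurableSpace Ξ] {ν : Measure Ξ}

theorem measurable_birkhoffSum (hT : Measurable T) (hg : Measurable g) (n : ℕ) :
    Measurable (birkhoffSum T g n) := by
  unfold birkhoffSum
  exact Finset.measurable_sum _ fun k _ => hg.comp (hT.iterate k)

theorem measurable_birkhoffMax (hT : Measurable T) (hg : Measurable g) (n : ℕ) :
    Measurable (birkhoffMax T g n) := by
  induction n with
  | zero => exact measurable_const
  | succ n ih => exact measurable_const.max (hg.add (ih.comp hT))

theorem integrable_birkhoffMax [IsFiniteMeasure ν] (hT : MeasurePreserving T ν ν)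
    (hg : Integrable g ν) (n : ℕ) : Integrable (birkhoffMax T g n) ν := by
  induction n with
  | zero => exact integrable_zero _ _ _
  | succ n ih =>
    exact (integrable_zero Ξ ℝ ν).sup (hg.add (hT.integrable_comp_of_integrable ih))

/-- A maximal ergodic argument. The set of bounded sums is invariant. If it were null, the running
maxima `M_n` would diverge and `M_{n+1} - M_n ∘ T = max (-M_n ∘ T) g` would tend to `g`, dominated
by `|g|`. Its integral is nonnegative because `M_n` increases with `n` and `T` preserves `ν`, so `g`
would have nonnegative mean. -/
theorem ae_bddAbove_birkhoffSum_of_integral_neg [IsProbabilityMeasure ν] (hT : Ergodic T ν)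
    (hgm : Measurable g) (hg : Integrable g ν) (hneg : ∫ ξ, g ξ ∂ν < 0) :
    ∀ᵐ ξ ∂ν, ∃ C : ℝ, ∀ n, birkhoffSum T g n ξ ≤ C := by
  have hbdd : ∀ ξ, (∃ C : ℝ, ∀ n, birkhoffSum T g n (T ξ) ≤ C) ↔
      ∃ C : ℝ, ∀ n, birkhoffSum T g n ξ ≤ C := by
    intro ξ
    constructor
    · rintro ⟨C, hC⟩
      refine ⟨max 0 (g ξ + C), fun n => ?_⟩
      cases n with
      | zero => simp
      | succ n => rw [birkhoffSum_succ']; exact le_max_of_le_right (by gcongr; exact hC n)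
    · rintro ⟨C, hC⟩
      refine ⟨C - g ξ, fun n => ?_⟩
      have := hC (n + 1)
      rw [birkhoffSum_succ'] at this
      linarith
  set A : Set Ξ := {ξ | ∃ C : ℝ, ∀ n, birkhoffSum T g n ξ ≤ C} with hA
  have hAm : MeasurableSet A := by
    have : A = ⋃ N : ℕ, ⋂ n, {ξ | birkhoffSum T g n ξ ≤ N} := by
      ext ξ
      simp only [hA, Set.mem_ofPred_eq, Set.mem_iUnion, Set.mem_iInter]
      constructor
      · rintro ⟨C, hC⟩
        obtain ⟨N, hN⟩ := exists_nat_ge C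
        exact ⟨N, fun n => (hC n).trans hN⟩
      · rintro ⟨N, hN⟩
        exact ⟨N, hN⟩
    rw [this]
    exact .iUnion fun N => .iInter fun n =>
      measurableSet_le (measurable_birkhoffSum hT.measurable hgm n) measurable_const
  have hAinv : T ⁻¹' A = A := by
    ext ξ; exact hbdd ξ
  rcases hT.toPreErgodic.ae_mem_or_ae_notMem hAm hAinv with h | h
  · exact h
  exfalso
  have hTm := hT.toMeasurePreserving
  have hM := integrable_birkhoffMax hTm hg
  have hMT : ∀ n, Integrable (fun ξ => birkhoffMax T g n (T ξ)) ν := fun n =>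
    hTm.integrable_comp_of_integrable (hM n)
  have hpos : ∀ n, 0 ≤ ∫ ξ, max (-birkhoffMax T g n (T ξ)) (g ξ) ∂ν := by
    intro n
    have h1 : ∀ ξ, max (-birkhoffMax T g n (T ξ)) (g ξ) =
        birkhoffMax T g (n + 1) ξ - birkhoffMax T g n (T ξ) := by
      intro ξ
      simp only [birkhoffMax]
      rw [max_sub_sub_right (0 : ℝ) (g ξ + birkhoffMax T g n (T ξ)) _ |>.symm]
      congr 1 <;> ring
    simp_rw [h1]
    rw [integral_sub (hM _) (hMT n)]
    have h2 : ∫ ξ, birkhoffMax T g n (T ξ) ∂ν = ∫ ξ, birkhoffMax T g n ξ ∂ν := by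
      conv_rhs => rw [← hTm.map_eq]
      rw [integral_map hTm.aemeasurable]
      exact (measurable_birkhoffMax hTm.measurable hgm n).aestronglyMeasurable
    rw [h2]
    exact sub_nonneg.2 (integral_mono (hM n) (hM _) fun ξ => birkhoffMax_le_succ n ξ)
  have hlim : Tendsto (fun n => ∫ ξ, max (-birkhoffMax T g n (T ξ)) (g ξ) ∂ν) atTop
      (𝓝 (∫ ξ, g ξ ∂ν)) := by
    refine tendsto_integral_of_dominated_convergence (fun ξ => |g ξ|) (fun n => ?_) hg.abs
      (fun n => ?_) ?_
    · exact ((hMT n).neg.sup hg).aestronglyMeasurable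
    · refine ae_of_all _ fun ξ => ?_
      have := birkhoffMax_nonneg (T := T) (g := g) n (T ξ)
      rw [Real.norm_eq_abs, abs_le]
      exact ⟨le_max_of_le_right (neg_abs_le _), max_le (by linarith [abs_nonneg (g ξ)])
        (le_abs_self _)⟩
    · filter_upwards [h] with ξ hξ
      have hξ' : ¬ ∃ C : ℝ, ∀ n, birkhoffSum T g n (T ξ) ≤ C := fun H => hξ ((hbdd ξ).1 H)
      push Not at hξ'
      obtain ⟨n₀, hn₀⟩ := hξ' (-g ξ)
      refine tendsto_const_nhds.congr' ?_
      filter_upwards [eventually_ge_atTop n₀] with n hn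
      have h3 : birkhoffMax T g n₀ (T ξ) ≤ birkhoffMax T g n (T ξ) :=
        monotone_nat_of_le_succ (f := fun n => birkhoffMax T g n (T ξ))
          (fun n => birkhoffMax_le_succ n _) hn
      have h4 := birkhoffSum_le_birkhoffMax (T := T) (g := g) n₀ (T ξ)
      rw [max_eq_right]
      linarith
  exact absurd (ge_of_tendsto' hlim hpos) (not_le.2 hneg)

theorem ae_birkhoffSum_le [IsProbabilityMeasure ν] (hT : Ergodic T ν)
    (hgm : Measurable g) (hg : Integrable g ν) {c : ℝ} (hc : ∫ ξ, g ξ ∂ν < c) :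
    ∀ᵐ ξ ∂ν, ∃ C : ℝ, ∀ n : ℕ, birkhoffSum T g n ξ ≤ n * c + C := by
  have h := ae_bddAbove_birkhoffSum_of_integral_neg hT (g := fun ξ => g ξ - c)
    (hgm.sub_const c) (hg.sub (integrable_const c)) (by
      rw [integral_sub hg (integrable_const c)]; simp; exact hc)
  filter_upwards [h] with ξ ⟨C, hC⟩
  refine ⟨C, fun n => ?_⟩
  have := hC n
  rw [birkhoffSum_sub_const] at this
  linarith

theorem ae_le_birkhoffSum [IsProbabilityMeasure ν] (hT : Ergodic T ν)
    (hgm : Measurable g) (hg : Integrable g ν) {c : ℝ} (hc : c < ∫ ξ, g ξ ∂ν) :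
    ∀ᵐ ξ ∂ν, ∃ C : ℝ, ∀ n : ℕ, n * c - C ≤ birkhoffSum T g n ξ := by
  have h := ae_birkhoffSum_le hT (g := -g) hgm.neg hg.neg (c := -c) (by
    simp only [Pi.neg_apply, integral_neg]; linarith)
  filter_upwards [h] with ξ ⟨C, hC⟩
  refine ⟨C, fun n => ?_⟩
  have := hC n
  rw [birkhoffSum_neg] at this
  linarith

/-- The increments of ergodic sums grow at most linearly, with the mean as rate. -/
theorem ae_birkhoffSum_sub_le [IsProbabilityMeasure ν] (hT : Ergodic T ν)
    (hgm : Measurable g) (hg : Integrable g ν) {ε : ℝ} (hε : 0 < ε) :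
    ∀ᵐ ξ ∂ν, ∃ C : ℝ, ∀ m n : ℕ, m ≤ n →
      birkhoffSum T g n ξ - birkhoffSum T g m ξ ≤ (n - m) * (∫ ξ, g ξ ∂ν) + ε * n + C := by
  filter_upwards [ae_birkhoffSum_le hT hgm hg (c := ∫ ξ, g ξ ∂ν + ε / 2) (by linarith),
    ae_le_birkhoffSum hT hgm hg (c := ∫ ξ, g ξ ∂ν - ε / 2) (by linarith)] with ξ ⟨C, hC⟩ ⟨D, hD⟩
  refine ⟨C + D, fun m n hmn => ?_⟩
  have h1 := hC n
  have h2 := hD m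
  have h3 : (m : ℝ) ≤ n := by exact_mod_cast hmn
  nlinarith [mul_le_mul_of_nonneg_left h3 hε.le]

/-- Along almost every orbit an integrable function grows sublinearly. -/
theorem ae_comp_iterate_le [IsProbabilityMeasure ν] (hT : Ergodic T ν)
    (hgm : Measurable g) (hg : Integrable g ν) {ε : ℝ} (hε : 0 < ε) :
    ∀ᵐ ξ ∂ν, ∃ C : ℝ, ∀ n : ℕ, g (T^[n] ξ) ≤ ε * n + C := by
  filter_upwards [ae_birkhoffSum_sub_le hT hgm hg hε] with ξ ⟨C, hC⟩
  refine ⟨C + ∫ ξ, g ξ ∂ν + ε, fun n => ?_⟩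
  have := hC n (n + 1) n.le_succ
  rw [birkhoffSum_succ] at this
  push_cast at this
  linarith

end ErgodicSums

/-! ### Exponential decay from contraction over blocks -/

section Decay

/-- Sliding the window by one exchanges `d n` for `d (n + r)`, at the price of one factor. The
exponents of all residues modulo `r` then enter, and their sum is an ergodic sum of the shift itself
rather than of its `r`-th power. -/
theorem prod_window_le {d : ℕ → ℝ≥0∞} {a : ℕ → ℝ} {r : ℕ} (hr : 0 < r)
    (h : ∀ n, d (n + r) ≤ ENNReal.ofReal (Real.exp (a n)) * d n) (n : ℕ) :
    ∏ j ∈ Finset.range r, d (n + j) ≤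
      ENNReal.ofReal (Real.exp (∑ s ∈ Finset.range n, a s)) * ∏ j ∈ Finset.range r, d j := by
  induction n with
  | zero => simp
  | succ n ih =>
    rw [Finset.sum_range_succ, add_comm _ (a n), Real.exp_add,
      ENNReal.ofReal_mul (Real.exp_pos _).le, mul_assoc]
    refine le_trans ?_ (mul_le_mul_right ih _)
    cases r with
    | zero => exact absurd hr (lt_irrefl 0)
    | succ r =>
      rw [Finset.prod_range_succ, Finset.prod_range_succ' _ r, mul_left_comm]
      have h1 : d (n + 1 + r) ≤ ENNReal.ofReal (Real.exp (a n)) * d (n + 0) := by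
        have := h n
        rwa [show n + (r + 1) = n + 1 + r by ring] at this
      have h2 : ∀ j, n + 1 + j = n + (j + 1) := fun j => by ring
      simp_rw [h2] at h1 ⊢
      exact mul_le_mul_right h1 _

/-- The geometric mean of the window decays at rate `δ`, hence so does its smallest term. -/
theorem exists_small_in_window {d : ℕ → ℝ≥0∞} {a : ℕ → ℝ} {r : ℕ} (hr : 0 < r) {C δ : ℝ}
    (hd : ∀ n, d n < ∞)
    (h : ∀ n, d (n + r) ≤ ENNReal.ofReal (Real.exp (a n)) * d n)
    (hS : ∀ n : ℕ, ∑ s ∈ Finset.range n, a s ≤ C - δ * r * n) :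
    ∃ D : ℝ, ∀ n : ℕ, ∃ j < r, d (n + j) ≤ ENNReal.ofReal (Real.exp (D - δ * n)) := by
  set p : ℝ≥0∞ := ENNReal.ofReal (Real.exp C) * ∏ j ∈ Finset.range r, d j with hp
  have hpfin : p ≠ ∞ := ENNReal.mul_ne_top ENNReal.ofReal_ne_top
    (ENNReal.prod_ne_top fun j _ => (hd j).ne)
  -- The constant `p` of the product bound itself serves as `D`: a window without a small term would
  -- give `exp (r * p) ≤ p`, which is impossible for `r ≥ 1`.
  refine ⟨p.toReal, fun n => ?_⟩
  by_contra! hcon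
  have h1 : ENNReal.ofReal (Real.exp (p.toReal - δ * n)) ^ r ≤
      ∏ j ∈ Finset.range r, d (n + j) := by
    calc _ = ∏ _j ∈ Finset.range r, ENNReal.ofReal (Real.exp (p.toReal - δ * n)) := by simp
      _ ≤ _ := Finset.prod_le_prod' fun j hj => (hcon j (Finset.mem_range.1 hj)).le
  have h2 : ∏ j ∈ Finset.range r, d (n + j) ≤ ENNReal.ofReal (Real.exp (-(δ * r * n))) * p := by
    refine (prod_window_le hr h n).trans ?_
    rw [hp, ← mul_assoc, ← ENNReal.ofReal_mul (Real.exp_pos _).le, ← Real.exp_add]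
    gcongr
    linarith [hS n]
  have h3 := h1.trans h2
  rw [← ENNReal.ofReal_toReal hpfin, ← ENNReal.ofReal_mul (Real.exp_pos _).le,
    ← ENNReal.ofReal_pow (Real.exp_pos _).le, ENNReal.toReal_ofReal ENNReal.toReal_nonneg,
    ENNReal.ofReal_le_ofReal_iff (by positivity), ← Real.exp_nat_mul,
    show (r : ℝ) * (p.toReal - δ * n) = -(δ * r * n) + r * p.toReal by ring, Real.exp_add] at h3
  have h4 := le_of_mul_le_mul_left h3 (Real.exp_pos _)
  have h5 : (1 : ℝ) ≤ r := by exact_mod_cast hr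
  have h6 := Real.add_one_le_exp ((r : ℝ) * p.toReal)
  nlinarith [ENNReal.toReal_nonneg (a := p)]

theorem le_exp_mul_of_steps {d : ℕ → ℝ≥0∞} {K : ℝ} {n : ℕ} (i : ℕ)
    (h : ∀ u, n ≤ u → u < n + i → d (u + 1) ≤ ENNReal.ofReal (Real.exp K) * d u) :
    d (n + i) ≤ ENNReal.ofReal (Real.exp (i * K)) * d n := by
  induction i with
  | zero => simp
  | succ i ih =>
    have h1 := ih fun u h1 h2 => h u h1 (by omega)
    have h2 := h (n + i) (by omega) (by omega)
    refine h2.trans ((mul_le_mul_right h1 _).trans (le_of_eq ?_))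
    rw [← mul_assoc, ← ENNReal.ofReal_mul (Real.exp_pos _).le, ← Real.exp_add]
    push_cast
    ring_nf

/-- Going back from `t` by steps of `r` ends in the window `[m + r, m + 2 * r)`. Only one residue
class of exponents is met; positive parts allow summing over all of `[m, t)`. -/
theorem le_exp_sum_mul_of_blocks {d : ℕ → ℝ≥0∞} {a : ℕ → ℝ} {r : ℕ} (hr : 0 < r)
    (h : ∀ n, d (n + r) ≤ ENNReal.ofReal (Real.exp (a n)) * d n) {m : ℕ} {c : ℝ≥0∞}
    (hc : ∀ u, m + r ≤ u → u < m + 2 * r → d u ≤ c) (t : ℕ) (ht : m + r ≤ t) :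
    d t ≤ ENNReal.ofReal (Real.exp (∑ s ∈ Finset.Ico m t, max (a s) 0)) * c := by
  induction t using Nat.strong_induction_on with
  | _ t ih =>
    by_cases h2 : t < m + 2 * r
    · refine (hc t ht h2).trans (le_mul_of_one_le_left' ?_)
      rw [ENNReal.one_le_ofReal, Real.one_le_exp_iff]
      exact Finset.sum_nonneg fun s _ => le_max_right _ _
    · obtain ⟨u, rfl⟩ : ∃ u, t = u + r := ⟨t - r, by omega⟩
      refine (h u).trans ((mul_le_mul_right (ih u (by omega) (by omega)) _).trans ?_)
      rw [← mul_assoc, ← ENNReal.ofReal_mul (Real.exp_pos _).le, ← Real.exp_add]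
      gcongr
      have h3 : Finset.Ico m (u + 1) ⊆ Finset.Ico m (u + r) := Finset.Ico_subset_Ico le_rfl (by omega)
      have h4 := Finset.sum_le_sum_of_subset_of_nonneg h3
        (f := fun s => max (a s) 0) fun s _ _ => le_max_right _ _
      rw [Finset.sum_Ico_succ_top (by omega)] at h4
      linarith [le_max_left (a u) 0]

/-- Exponential decay of a sequence controlled over blocks of length `r` by factors with negative
exponents on average, and over single steps by factors that are bounded at the good times. -/
theorem exists_exp_bound_of_good_times {d : ℕ → ℝ≥0∞} {a : ℕ → ℝ} {r : ℕ} (hr : 0 < r)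
    {C₁ C₂ δ ε K c : ℝ} (hδ : δ ≤ 1) (hc : 0 ≤ c) (hK : 0 ≤ K)
    (hd : ∀ n, d n < ∞)
    (h : ∀ n, d (n + r) ≤ ENNReal.ofReal (Real.exp (a n)) * d n)
    (hS : ∀ n : ℕ, ∑ s ∈ Finset.range n, a s ≤ C₁ - δ * r * n)
    (good : ℕ → Prop)
    (hgood : ∀ m, good m → ∀ i < 2 * r,
      d (m + i + 1) ≤ ENNReal.ofReal (Real.exp K) * d (m + i))
    {χ : ℕ → ℝ} (hχ : ∀ s, χ s ≤ 1) (hχgood : ∀ s, ¬ good s → χ s ≤ 0)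
    (hw : ∀ m n : ℕ, m ≤ n →
      ∑ s ∈ Finset.Ico m n, (max (a s) 0 + 1 - c * χ s) ≤ ε * n + C₂) :
    ∃ C : ℝ, ∀ t : ℕ, r ≤ t → d t ≤ ENNReal.ofReal (Real.exp (C - (δ - ε) * t)) := by
  classical
  obtain ⟨D, hD⟩ := exists_small_in_window hr hd h hS
  set p : ℝ≥0∞ := ∑ u ∈ Finset.range (2 * r), d u with hp
  have hpfin : p ≠ ∞ := by
    rw [hp]; exact ENNReal.sum_ne_top.2 fun u _ => (hd u).ne
  set D' : ℝ := max p.toReal (2 * r * K + D) with hD'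
  -- From the small term in `[m, m + r)`, fewer than `2 * r` single steps, each costing at most `exp
  -- K`, reach any time of `[m + r, m + 2 * r)`. Time `0` is admitted so that a last admissible time
  -- always exists.
  have hwin : ∀ m, (m = 0 ∨ good m) → ∀ u, m + r ≤ u → u < m + 2 * r →
      d u ≤ ENNReal.ofReal (Real.exp (D' - δ * m)) := by
    rintro m (rfl | hm) u hu1 hu2
    · calc d u ≤ p := Finset.single_le_sum (f := d) (fun _ _ => zero_le)
            (Finset.mem_range.2 (by omega))
        _ = ENNReal.ofReal p.toReal := (ENNReal.ofReal_toReal hpfin).symm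
        _ ≤ _ := by
          refine ENNReal.ofReal_le_ofReal ?_
          have := Real.add_one_le_exp (D' - δ * (0 : ℕ))
          have h0 : p.toReal ≤ D' := le_max_left _ _
          simp only [Nat.cast_zero, mul_zero, sub_zero] at this ⊢
          linarith
    · obtain ⟨j, hj, hdj⟩ := hD m
      obtain ⟨i, rfl⟩ : ∃ i, u = m + j + i := ⟨u - m - j, by omega⟩
      have h1 := le_exp_mul_of_steps (d := d) (K := K) (n := m + j) i fun v hv1 hv2 => by
        have := hgood m hm (v - m) (by omega)
        rwa [show m + (v - m) = v by omega] at this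
      refine h1.trans ((mul_le_mul_right hdj _).trans ?_)
      rw [← ENNReal.ofReal_mul (Real.exp_pos _).le, ← Real.exp_add]
      gcongr
      have h2 : (i : ℝ) * K ≤ 2 * r * K := by
        gcongr
        have : i ≤ 2 * r := by omega
        exact_mod_cast this
      have h3 : 2 * r * K + D ≤ D' := le_max_right _ _
      linarith
  refine ⟨D' + C₂ + c * (r + 1), fun t ht => ?_⟩
  set m := Nat.findGreatest (fun m => m = 0 ∨ good m) (t - r) with hm
  have hmt : m ≤ t - r := Nat.findGreatest_le _
  have hmgood : m = 0 ∨ good m :=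
    Nat.findGreatest_spec (P := fun m => m = 0 ∨ good m) (zero_le) (Or.inl rfl)
  have hlast : ∀ s, m < s → s ≤ t - r → ¬ good s := fun s h1 h2 h3 =>
    Nat.findGreatest_is_greatest (P := fun m => m = 0 ∨ good m) h1 h2 (Or.inr h3)
  have hdt := le_exp_sum_mul_of_blocks hr h (hwin m hmgood) t (by omega)
  rw [← ENNReal.ofReal_mul (Real.exp_pos _).le, ← Real.exp_add] at hdt
  refine hdt.trans (ENNReal.ofReal_le_ofReal (Real.exp_le_exp.2 ?_))
  -- The search stops at `t - r`, so a good time of `[m, t)` is either `m` or one of the last `r`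
  -- times.
  have hcount : ∑ s ∈ Finset.Ico m t, χ s ≤ r + 1 := by
    calc ∑ s ∈ Finset.Ico m t, χ s
        ≤ ∑ s ∈ Finset.Ico m t, if s ∈ insert m (Finset.Ico (t - r) t) then (1 : ℝ) else 0 := by
          refine Finset.sum_le_sum fun s hs => ?_
          split_ifs with hcon
          · exact hχ s
          · rw [Finset.mem_insert, Finset.mem_Ico] at hcon
            rw [Finset.mem_Ico] at hs
            exact hχgood s (hlast s (by omega) (by omega))
      _ ≤ ((insert m (Finset.Ico (t - r) t)).card : ℝ) := by
          rw [Finset.sum_boole]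
          exact_mod_cast Finset.card_le_card fun s hs => (Finset.mem_filter.1 hs).2
      _ ≤ r + 1 := by
          have hcard := Finset.card_insert_le m (Finset.Ico (t - r) t)
          rw [Nat.card_Ico] at hcard
          exact_mod_cast hcard.trans (by omega)
  -- The `+ 1` in the weights gains `t - m` in the exponent. Since `δ ≤ 1`, this turns the decay `δ
  -- * m` reached at the last good time into `δ * t`.
  have hwt := hw m t (by omega)
  rw [Finset.sum_sub_distrib, Finset.sum_add_distrib, ← Finset.mul_sum, Finset.sum_const,
    Nat.card_Ico, nsmul_eq_mul, Nat.cast_sub (by omega)] at hwt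
  have h5 := mul_le_mul_of_nonneg_left hcount hc
  have h6 : (0 : ℝ) ≤ t - m := by
    have : (m : ℝ) ≤ t := by exact_mod_cast (by omega : m ≤ t)
    linarith
  nlinarith

variable {Ξ : Type*} [MeasurableSpace Ξ] {ν : Measure Ξ} {T : Ξ → Ξ}

theorem ae_iterate {Q : Ξ → Prop} (hT : MeasurePreserving T ν ν) (h : ∀ᵐ ξ ∂ν, Q ξ) :
    ∀ᵐ ξ ∂ν, ∀ n : ℕ, Q (T^[n] ξ) :=
  ae_all_iff.2 fun n => (hT.iterate n).quasiMeasurePreserving.ae h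

/-- The exceptional null set does not depend on `d`, so the bound applies to all solutions and to
suprema over parameters. Finiteness of `k` suffices because its size is used only at times when it
is bounded over a window. -/
theorem ae_eventually_le_exp_of_ergodic [IsProbabilityMeasure ν] (hT : Ergodic T ν)
    {k : Ξ → ℝ≥0∞} (hk : Measurable k) (hkfin : ∀ᵐ ξ ∂ν, k ξ < ∞) {l : Ξ → ℝ}
    (hlm : Measurable l) (hl : Integrable l ν) (hneg : ∫ ξ, l ξ ∂ν < 0) {r : ℕ} (hr : 0 < r) :
    ∃ δ : ℝ, 0 < δ ∧ ∀ᵐ ξ ∂ν, ∀ d : ℕ → ℝ≥0∞, d 0 < ∞ →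
      (∀ n, d (n + 1) ≤ k (T^[n] ξ) * d n) →
      (∀ n, d (n + r) ≤ ENNReal.ofReal (Real.exp (l (T^[n] ξ))) * d n) →
      ∀ᶠ n : ℕ in atTop, d n ≤ ENNReal.ofReal (Real.exp (-δ * n)) := by
  classical
  have hTm := hT.toMeasurePreserving
  have hr' : (0 : ℝ) < r := by exact_mod_cast hr
  -- a bound that holds with positive probability over a window
  obtain ⟨K, hK⟩ : ∃ K : ℕ,
      ν {ξ | ∀ i < 2 * r, k (T^[i] ξ) ≤ ENNReal.ofReal (Real.exp K)} ≠ 0 := by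
    by_contra! hcon
    have h0 : ∀ᵐ ξ ∂ν, ∀ K : ℕ, ¬ ∀ i < 2 * r, k (T^[i] ξ) ≤ ENNReal.ofReal (Real.exp K) :=
      ae_all_iff.2 fun K => by simpa only [ae_iff, not_not] using hcon K
    obtain ⟨ξ, h1, h2⟩ := (h0.and (ae_iterate hTm hkfin)).exists
    set s : ℝ≥0∞ := ∑ i ∈ Finset.range (2 * r), k (T^[i] ξ) with hs
    have hsfin : s ≠ ∞ := by rw [hs]; exact ENNReal.sum_ne_top.2 fun u _ => (h2 u).ne
    obtain ⟨K, hK⟩ := exists_nat_ge s.toReal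
    refine h1 K fun i hi => ?_
    calc k (T^[i] ξ) ≤ s := Finset.single_le_sum (f := fun i => k (T^[i] ξ))
          (fun _ _ => zero_le) (Finset.mem_range.2 hi)
      _ = ENNReal.ofReal s.toReal := (ENNReal.ofReal_toReal hsfin).symm
      _ ≤ _ := ENNReal.ofReal_le_ofReal (by linarith [Real.add_one_le_exp (K : ℝ)])
  set G : Set Ξ := {ξ | ∀ i < 2 * r, k (T^[i] ξ) ≤ ENNReal.ofReal (Real.exp K)} with hG
  have hGm : MeasurableSet G := by
    have : G = ⋂ i, ⋂ (_ : i < 2 * r), {ξ | k (T^[i] ξ) ≤ ENNReal.ofReal (Real.exp K)} := by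
      ext ξ; simp [hG]
    rw [this]
    exact .iInter fun i => .iInter fun _ =>
      measurableSet_le (hk.comp (hT.measurable.iterate i)) measurable_const
  have hGpos : 0 < ν.real G := ENNReal.toReal_pos hK (measure_ne_top _ _)
  have hlp : Integrable (fun ξ => max (l ξ) 0) ν := hl.sup (integrable_zero _ _ _)
  -- This `c` gives the weight `w` mean zero, so that the increments of its ergodic sums are
  -- sublinear.
  set c : ℝ := (∫ ξ, max (l ξ) 0 ∂ν + 1) / ν.real G with hc
  have hc0 : 0 ≤ c := div_nonneg
    (add_nonneg (integral_nonneg fun ξ => le_max_right _ _) zero_le_one) hGpos.le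
  set w : Ξ → ℝ := fun ξ => max (l ξ) 0 + 1 - c * G.indicator 1 ξ with hw
  have hind : Measurable (G.indicator (1 : Ξ → ℝ)) := measurable_one.indicator hGm
  have hindi : Integrable (G.indicator (1 : Ξ → ℝ)) ν := (integrable_const (1 : ℝ)).indicator hGm
  have hwm : Measurable w := ((hlm.max measurable_const).add_const 1).sub (hind.const_mul c)
  have hwi : Integrable w ν := (hlp.add (integrable_const 1)).sub (hindi.const_mul c)
  have hwint : ∫ ξ, w ξ ∂ν = 0 := by
    have h1 : ∫ ξ, w ξ ∂ν = ∫ ξ, (max (l ξ) 0 + 1) ∂ν - ∫ ξ, c * G.indicator 1 ξ ∂ν :=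
      integral_sub (hlp.add (integrable_const 1)) (hindi.const_mul c)
    rw [h1, integral_add hlp (integrable_const 1), integral_const_mul, integral_indicator_one hGm,
      hc]
    simp
    field_simp
    ring
  set δ : ℝ := min 1 (-(∫ ξ, l ξ ∂ν) / (2 * r)) with hδ
  have hδ0 : 0 < δ := lt_min one_pos (by apply div_pos <;> linarith)
  have hδl : ∫ ξ, l ξ ∂ν < -(δ * r) := by
    have h1 : δ ≤ -(∫ ξ, l ξ ∂ν) / (2 * r) := min_le_right _ _
    rw [le_div_iff₀ (by positivity)] at h1
    linarith
  -- Half of `δ` pays for the fluctuations of the ergodic sums of `w`, and a further quarter absorbs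
  -- the constant `C`.
  refine ⟨δ / 4, by positivity, ?_⟩
  filter_upwards [ae_iterate hTm hkfin, ae_birkhoffSum_le hT hlm hl hδl,
    ae_birkhoffSum_sub_le hT hwm hwi (half_pos hδ0)] with ξ hkξ ⟨C₁, hC₁⟩ ⟨C₂, hC₂⟩ d hd0 hd1 hdr
  have hd : ∀ n, d n < ∞ := by
    intro n
    induction n with
    | zero => exact hd0
    | succ n ih => exact (hd1 n).trans_lt (ENNReal.mul_lt_top (hkξ n) ih)
  obtain ⟨C, hC⟩ := exists_exp_bound_of_good_times (d := d) (a := fun n => l (T^[n] ξ)) hr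
    (C₁ := C₁) (C₂ := C₂) (ε := δ / 2) (K := K) (min_le_left _ _) hc0 (Nat.cast_nonneg K) hd hdr
    (fun n => by have := hC₁ n; simp only [birkhoffSum] at this; linarith)
    (fun n => T^[n] ξ ∈ G)
    (fun m hm i hi => by
      refine (hd1 (m + i)).trans (mul_le_mul_left ?_ _)
      have := hm i hi
      rwa [← Function.iterate_add_apply, add_comm] at this)
    (χ := fun s => G.indicator 1 (T^[s] ξ))
    (fun s => Set.indicator_le_self' (fun _ _ => zero_le_one) _)
    (fun s hs => (Set.indicator_of_notMem hs _).le)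
    (fun m n hmn => by
      have := hC₂ m n hmn
      rw [hwint] at this
      simp only [birkhoffSum] at this
      rw [← Finset.sum_range_add_sum_Ico _ hmn, add_sub_cancel_left] at this
      simpa only [mul_zero, zero_add] using this)
  have hev : ∀ᶠ n : ℕ in atTop, C / (δ / 4) ≤ n :=
    (tendsto_natCast_atTop_atTop (R := ℝ)).eventually_ge_atTop _
  filter_upwards [eventually_ge_atTop r, hev] with n hn1 hn2
  refine (hC n hn1).trans (ENNReal.ofReal_le_ofReal (Real.exp_le_exp.2 ?_))
  rw [div_le_iff₀ (by positivity)] at hn2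
  linarith

end Decay

/-! ### Positive and negative parts of the logarithm -/

section LogMoments

theorem continuous_logPlus : Continuous logPlus :=
  EReal.continuous_toENNReal.comp ENNReal.continuous_log

theorem continuous_logMinus : Continuous logMinus :=
  EReal.continuous_toENNReal.comp (continuous_neg.comp ENNReal.continuous_log)

theorem monotone_logPlus : Monotone logPlus := fun _ _ h =>
  EReal.toENNReal_le_toENNReal (ENNReal.log_monotone h)

theorem antitone_logMinus : Antitone logMinus := fun _ _ h =>
  EReal.toENNReal_le_toENNReal (EReal.neg_le_neg_iff.2 (ENNReal.log_monotone h))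

theorem logPlus_ofReal {a : ℝ} (ha : 0 < a) :
    logPlus (ENNReal.ofReal a) = ENNReal.ofReal (Real.log a) := by
  rw [logPlus, ENNReal.log_ofReal_of_pos ha, EReal.real_coe_toENNReal]

theorem logMinus_ofReal {a : ℝ} (ha : 0 < a) :
    logMinus (ENNReal.ofReal a) = ENNReal.ofReal (-Real.log a) := by
  rw [logMinus, ENNReal.log_ofReal_of_pos ha, ← EReal.coe_neg, EReal.real_coe_toENNReal]

theorem logPlus_lt_top_iff {a : ℝ≥0∞} : logPlus a < ∞ ↔ a < ∞ := by
  rw [logPlus, lt_top_iff_ne_top, EReal.toENNReal_ne_top_iff, Ne, ENNReal.log_eq_top_iff,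
    lt_top_iff_ne_top]

theorem le_exp_logPlus_sub_logMinus {a : ℝ≥0∞} (ha : a < ∞) (M : ℕ) :
    a ≤ ENNReal.ofReal (Real.exp ((logPlus a).toReal - (min (logMinus a) M).toReal)) := by
  rcases eq_or_ne a 0 with rfl | h0
  · exact zero_le
  obtain ⟨x, hx, rfl⟩ : ∃ x : ℝ, 0 < x ∧ a = ENNReal.ofReal x :=
    ⟨a.toReal, ENNReal.toReal_pos h0 ha.ne, (ENNReal.ofReal_toReal ha.ne).symm⟩
  rw [logPlus_ofReal hx, logMinus_ofReal hx,
    ENNReal.toReal_min ENNReal.ofReal_ne_top (ENNReal.natCast_ne_top M),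
    ENNReal.toReal_ofReal', ENNReal.toReal_ofReal', ENNReal.toReal_natCast]
  refine ENNReal.ofReal_le_ofReal ((Real.log_le_iff_le_exp hx).1 ?_)
  have h1 : min (max (-Real.log x) 0) (M : ℝ) ≤ max (-Real.log x) 0 := min_le_left _ _
  rcases le_total (Real.log x) 0 with h | h
  · rw [max_eq_right h]
    rw [max_eq_left (by linarith : (0 : ℝ) ≤ -Real.log x)] at h1 ⊢
    linarith
  · rw [max_eq_left h]
    rw [max_eq_right (by linarith : -Real.log x ≤ (0 : ℝ))] at h1 ⊢
    linarith

theorem le_exp_logPlus {a : ℝ≥0∞} (ha : a < ∞) :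
    a ≤ ENNReal.ofReal (Real.exp (logPlus a).toReal) := by
  simpa using le_exp_logPlus_sub_logMinus ha 0

variable {Ξ : Type*} [MeasurableSpace Ξ] {ν : Measure Ξ}

/-- A random variable with negative logarithmic mean is bounded by the exponential of an
integrable variable with negative mean. -/
theorem exists_integrable_exponent {L : Ξ → ℝ≥0∞} (hL : Measurable L)
    (hfin : ∫⁻ ξ, logPlus (L ξ) ∂ν < ∞)
    (hneg : ∫⁻ ξ, logPlus (L ξ) ∂ν < ∫⁻ ξ, logMinus (L ξ) ∂ν) [IsFiniteMeasure ν] :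
    ∃ l : Ξ → ℝ, Measurable l ∧ Integrable l ν ∧ ∫ ξ, l ξ ∂ν < 0 ∧
      ∀ᵐ ξ ∂ν, L ξ ≤ ENNReal.ofReal (Real.exp (l ξ)) := by
  have hp : Measurable fun ξ => logPlus (L ξ) := continuous_logPlus.measurable.comp hL
  have hm : Measurable fun ξ => logMinus (L ξ) := continuous_logMinus.measurable.comp hL
  have hmM : ∀ M : ℕ, Measurable fun ξ => min (logMinus (L ξ)) (M : ℝ≥0∞) := fun M =>
    hm.min measurable_const
  -- `logMinus` may fail to be integrable, or even be infinite. By monotone convergence a truncation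
  -- keeps the strict inequality.
  obtain ⟨M, hM⟩ : ∃ M : ℕ,
      ∫⁻ ξ, logPlus (L ξ) ∂ν < ∫⁻ ξ, min (logMinus (L ξ)) (M : ℝ≥0∞) ∂ν := by
    rw [← lt_iSup_iff, ← lintegral_iSup hmM]
    · refine hneg.trans_le (lintegral_mono fun ξ => ?_)
      rw [← inf_iSup_eq, ENNReal.iSup_natCast]
      exact le_inf le_rfl le_top
    · intro i j hij ξ
      exact min_le_min le_rfl (by exact_mod_cast hij)
  have hMfin : ∫⁻ ξ, min (logMinus (L ξ)) (M : ℝ≥0∞) ∂ν < ∞ :=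
    (lintegral_mono fun ξ => min_le_right _ _).trans_lt (by
      rw [lintegral_const]
      exact ENNReal.mul_lt_top (ENNReal.natCast_lt_top M) (measure_lt_top _ _))
  have hpi : Integrable (fun ξ => (logPlus (L ξ)).toReal) ν :=
    integrable_toReal_of_lintegral_ne_top hp.aemeasurable hfin.ne
  have hmi : Integrable (fun ξ => (min (logMinus (L ξ)) (M : ℝ≥0∞)).toReal) ν :=
    integrable_toReal_of_lintegral_ne_top (hmM M).aemeasurable hMfin.ne
  refine ⟨fun ξ => (logPlus (L ξ)).toReal - (min (logMinus (L ξ)) (M : ℝ≥0∞)).toReal,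
    hp.ennreal_toReal.sub (hmM M).ennreal_toReal, hpi.sub hmi, ?_, ?_⟩
  · rw [integral_sub hpi hmi, integral_toReal hp.aemeasurable (ae_lt_top hp hfin.ne),
      integral_toReal (hmM M).aemeasurable (ae_lt_top (hmM M) hMfin.ne), sub_neg]
    exact (ENNReal.toReal_lt_toReal hfin.ne hMfin.ne).2 hM
  · filter_upwards [ae_lt_top hp hfin.ne] with ξ hξ
    exact le_exp_logPlus_sub_logMinus (logPlus_lt_top_iff.1 hξ) M

end LogMoments

/-! ### Suprema over small balls of parameters -/

section Suprema

theorem biSup_le_biSup_of_subset_closure {A : Type*} [TopologicalSpace A] {f : A → ℝ≥0∞}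
    (hf : Continuous f) {s t : Set A} (hst : s ⊆ closure t) :
    ⨆ x ∈ s, f x ≤ ⨆ x ∈ t, f x := by
  refine iSup₂_le fun x hx => ?_
  have hcl : IsClosed {x | f x ≤ ⨆ x ∈ t, f x} := isClosed_le hf continuous_const
  exact hcl.closure_subset_iff.2 (fun z hz => le_iSup₂ (f := fun x (_ : x ∈ t) => f x) z hz)
    (hst hx)

variable {Ω Θ : Type*} [MeasurableSpace Ω] {μ : Measure Ω} [MetricSpace Θ]

theorem tendsto_biSup_closedBall {f : Θ → ℝ≥0} (hf : Continuous f) (θ : Θ) :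
    Tendsto (fun n : ℕ => ⨆ θ' ∈ Metric.closedBall θ (1 / ((n : ℝ) + 1)), (f θ' : ℝ≥0∞)) atTop
      (𝓝 (f θ)) := by
  have hge : ∀ n : ℕ, (f θ : ℝ≥0∞) ≤
      ⨆ θ' ∈ Metric.closedBall θ (1 / ((n : ℝ) + 1)), (f θ' : ℝ≥0∞) := fun n =>
    le_iSup₂ (f := fun θ' (_ : θ' ∈ Metric.closedBall θ (1 / ((n : ℝ) + 1))) => (f θ' : ℝ≥0∞)) θ
      (Metric.mem_closedBall_self (by positivity))
  refine tendsto_order.2 ⟨fun a ha => Eventually.of_forall fun n => ha.trans_le (hge n), ?_⟩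
  intro a ha
  obtain ⟨b, hb1, hb2⟩ := exists_between ha
  have hnhds : ∀ᶠ θ' in 𝓝 θ, (f θ' : ℝ≥0∞) < b :=
    ((ENNReal.continuous_coe.comp hf).tendsto θ).eventually_lt_const hb1
  obtain ⟨ε, hε, hball⟩ := Metric.eventually_nhds_iff.1 hnhds
  filter_upwards [tendsto_one_div_add_atTop_nhds_zero_nat.eventually_lt_const hε] with n hn
  exact (iSup₂_le fun θ' hθ' =>
    (hball (lt_of_le_of_lt (Metric.mem_closedBall.1 hθ') hn)).le).trans_lt hb2

variable [CompactSpace Θ]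

/-- By continuity the supremum is almost surely one over a countable dense subset of `s`. -/
theorem aemeasurable_biSup_of_continuous {f : Ω → Θ → ℝ≥0} (hm : ∀ θ, Measurable fun ω => f ω θ)
    (hc : ∀ᵐ ω ∂μ, Continuous (f ω)) (s : Set Θ) :
    AEMeasurable (fun ω => ⨆ θ ∈ s, (f ω θ : ℝ≥0∞)) μ := by
  obtain ⟨t, hts, htc, hst⟩ :=
    (TopologicalSpace.IsSeparable.of_separableSpace s).exists_countable_dense_subset
  refine ⟨fun ω => ⨆ θ ∈ t, (f ω θ : ℝ≥0∞), .biSup t htc fun θ _ => (hm θ).coe_nnreal_ennreal, ?_⟩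
  filter_upwards [hc] with ω hω
  exact le_antisymm (biSup_le_biSup_of_subset_closure (ENNReal.continuous_coe.comp hω) hst)
    (biSup_mono hts)

/-- A negative logarithmic mean at a point gives a negative logarithmic mean of the supremum over
a neighbourhood. -/
theorem exists_closedBall_negativeLogMean {f : Ω → Θ → ℝ≥0}
    (hm : ∀ θ, Measurable fun ω => f ω θ) (hc : ∀ᵐ ω ∂μ, Continuous (f ω))
    (hsup : ∫⁻ ω, ⨆ θ, logPlus (f ω θ) ∂μ < ∞) {θ : Θ}
    (hneg : NegativeLogMean μ fun ω => f ω θ) :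
    ∃ ε : ℝ, 0 < ε ∧ ∫⁻ ω, logPlus (⨆ θ' ∈ Metric.closedBall θ ε, (f ω θ' : ℝ≥0∞)) ∂μ <
      ∫⁻ ω, logMinus (⨆ θ' ∈ Metric.closedBall θ ε, (f ω θ' : ℝ≥0∞)) ∂μ := by
  set s : ℕ → Ω → ℝ≥0∞ := fun n ω =>
    ⨆ θ' ∈ Metric.closedBall θ (1 / ((n : ℝ) + 1)), (f ω θ' : ℝ≥0∞) with hs
  have hsm : ∀ n, AEMeasurable (s n) μ := fun n => aemeasurable_biSup_of_continuous hm hc _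
  have hanti : ∀ ω, Antitone fun n => s n ω := fun ω m n hmn =>
    biSup_mono fun θ' hθ' => Metric.closedBall_subset_closedBall
      (by have : (m : ℝ) ≤ n := by exact_mod_cast hmn
          gcongr) hθ'
  have hlog : ∀ ω, ∀ t : Set Θ,
      logPlus (⨆ θ' ∈ t, (f ω θ' : ℝ≥0∞)) ≤ ⨆ θ, logPlus (f ω θ) := fun ω t =>
    (monotone_logPlus (iSup_mono fun θ' => iSup_const_le)).trans
      (monotone_logPlus.map_iSup_of_continuousAt continuous_logPlus.continuousAt
        (by simp [logPlus])).le
  have hplus : Tendsto (fun n => ∫⁻ ω, logPlus (s n ω) ∂μ) atTop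
      (𝓝 (∫⁻ ω, logPlus (f ω θ) ∂μ)) := by
    refine tendsto_lintegral_of_dominated_convergence' (fun ω => ⨆ θ, logPlus (f ω θ))
      (fun n => continuous_logPlus.measurable.comp_aemeasurable (hsm n)) 
      (fun n => ae_of_all _ fun ω => hlog ω _) hsup.ne ?_
    · filter_upwards [hc] with ω hω
      exact (continuous_logPlus.tendsto _).comp (tendsto_biSup_closedBall hω θ)
  -- No domination is available here and the limit may be infinite, but `logMinus` increases as the
  -- ball shrinks.
  have hminus : Tendsto (fun n => ∫⁻ ω, logMinus (s n ω) ∂μ) atTop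
      (𝓝 (∫⁻ ω, logMinus (f ω θ) ∂μ)) := by
    refine lintegral_tendsto_of_tendsto_of_monotone
      (fun n => continuous_logMinus.measurable.comp_aemeasurable (hsm n)) ?_ ?_
    · exact ae_of_all _ fun ω m n hmn => antitone_logMinus (hanti ω hmn)
    · filter_upwards [hc] with ω hω
      exact (continuous_logMinus.tendsto _).comp (tendsto_biSup_closedBall hω θ)
  obtain ⟨n, hn⟩ := (hplus.eventually_lt hminus hneg).exists
  exact ⟨1 / ((n : ℝ) + 1), by positivity, hn⟩

end Suprema

/-! ### Measurable Lipschitz coefficients -/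

section Dilation

variable {Θ E : Type*} [MetricSpace E]

/-- The largest Lipschitz coefficient on `D` of the maps `f θ`, `θ ∈ B`. -/
noncomputable def dilation (B : Set Θ) (D : Set E) (f : Θ → E → E) : ℝ≥0∞ :=
  ⨆ θ ∈ B, ⨆ x ∈ D, ⨆ y ∈ D, edist (f θ x) (f θ y) / edist x y

variable {B B₀ : Set Θ} {D : Set E} {f : Θ → E → E}

theorem edist_le_dilation_mul {θ : Θ} (hθ : θ ∈ B) {x y : E} (hx : x ∈ D) (hy : y ∈ D) :
    edist (f θ x) (f θ y) ≤ dilation B D f * edist x y := by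
  rcases eq_or_ne x y with rfl | hxy
  · simp
  rw [← ENNReal.div_le_iff (edist_pos.2 hxy).ne' (edist_ne_top _ _)]
  refine le_trans ?_ (le_iSup₂ (f := fun θ (_ : θ ∈ B) => ⨆ x ∈ D, ⨆ y ∈ D,
    edist (f θ x) (f θ y) / edist x y) θ hθ)
  refine le_trans ?_ (le_iSup₂ (f := fun x (_ : x ∈ D) => ⨆ y ∈ D,
    edist (f θ x) (f θ y) / edist x y) x hx)
  exact le_iSup₂ (f := fun y (_ : y ∈ D) => edist (f θ x) (f θ y) / edist x y) y hy

theorem dilation_le {c : ℝ≥0∞}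
    (h : ∀ θ ∈ B, ∀ x ∈ D, ∀ y ∈ D, edist (f θ x) (f θ y) ≤ c * edist x y) :
    dilation B D f ≤ c :=
  iSup₂_le fun θ hθ => iSup₂_le fun x hx => iSup₂_le fun y hy =>
    ENNReal.div_le_of_le_mul (h θ hθ x hx y hy)

/-- This recovers the bound for all points and parameters from countable dense sets, over which the
coefficient is measurable. An infinite coefficient is set apart because multiplication by `∞` is not
continuous at `0`. -/
theorem edist_le_dilation_mul_of_dense [TopologicalSpace Θ] (hB : B ⊆ closure B₀) (hD : Dense D)
    (hfθ : ∀ x, Continuous fun θ => f θ x) (hfx : ∀ θ, Continuous (f θ)) {θ : Θ} (hθ : θ ∈ B)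
    (x y : E) : edist (f θ x) (f θ y) ≤ dilation B₀ D f * edist x y := by
  rcases eq_or_ne x y with rfl | hxy
  · simp
  rcases eq_or_ne (dilation B₀ D f) ∞ with htop | htop
  · rw [htop, ENNReal.top_mul (edist_pos.2 hxy).ne']
    exact le_top
  have h1 : ∀ θ ∈ B₀, edist (f θ x) (f θ y) ≤ dilation B₀ D f * edist x y := by
    intro θ hθ
    have hcl : IsClosed {z : E × E | edist (f θ z.1) (f θ z.2) ≤
        dilation B₀ D f * edist z.1 z.2} := by
      refine isClosed_le ?_ ?_
      · exact ((hfx θ).comp continuous_fst).edist ((hfx θ).comp continuous_snd)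
      · exact (ENNReal.continuous_const_mul htop).comp continuous_edist
    have hsub : D ×ˢ D ⊆ {z : E × E | edist (f θ z.1) (f θ z.2) ≤
        dilation B₀ D f * edist z.1 z.2} := fun z hz => edist_le_dilation_mul hθ hz.1 hz.2
    exact hcl.closure_subset_iff.2 hsub ((hD.prod hD) (x, y))
  have hcl : IsClosed {θ | edist (f θ x) (f θ y) ≤ dilation B₀ D f * edist x y} :=
    isClosed_le ((hfθ x).edist (hfθ y)) continuous_const
  exact hcl.closure_subset_iff.2 (fun z hz => h1 z hz) (hB hθ)

theorem measurable_dilation {Ξ : Type*} [MeasurableSpace Ξ] [MeasurableSpace E]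
    [OpensMeasurableSpace E] [SecondCountableTopology E] (hB : B.Countable) (hD : D.Countable)
    {f : Ξ → Θ → E → E} (hf : ∀ θ x, Measurable fun ξ => f ξ θ x) :
    Measurable fun ξ => dilation B D (f ξ) :=
  .biSup B hB fun θ _ => .biSup D hD fun x _ => .biSup D hD fun y _ =>
    ((hf θ x).edist (hf θ y)).div_const _

end Dilation

/-! ### Path space and its shift -/

section Shift

variable {Ω S E : Type*} [MeasurableSpace S]

/-- The left shift as a measurable equivalence of path space. -/
def seqShiftEquiv (S : Type*) [MeasurableSpace S] : (ℤ → S) ≃ᵐ (ℤ → S) where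
  toFun := seqShift S
  invFun x t := x (t - 1)
  left_inv x := by ext t; simp [seqShift]
  right_inv x := by ext t; simp [seqShift]
  measurable_toFun := measurable_pi_lambda _ fun t => measurable_pi_apply (t + 1)
  measurable_invFun := measurable_pi_lambda _ fun t => measurable_pi_apply (t - 1)

/-- The path of the process `X`, seen from time `t`. -/
def shiftPath (X : ℤ → Ω → S) (t : ℤ) (ω : Ω) : ℤ → S := fun s => X (s + t) ω

theorem seqShiftEquiv_shiftPath (X : ℤ → Ω → S) (t : ℤ) (ω : Ω) :
    seqShiftEquiv S (shiftPath X t ω) = shiftPath X (t + 1) ω := by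
  ext s
  change X (s + 1 + t) ω = X (s + (t + 1)) ω
  congr 1; ring

theorem seqShiftEquiv_symm_shiftPath (X : ℤ → Ω → S) (t : ℤ) (ω : Ω) :
    (seqShiftEquiv S).symm (shiftPath X t ω) = shiftPath X (t - 1) ω := by
  rw [MeasurableEquiv.symm_apply_eq, seqShiftEquiv_shiftPath, sub_add_cancel]

theorem iterate_seqShiftEquiv_shiftPath (X : ℤ → Ω → S) (t : ℤ) (ω : Ω) (n : ℕ) :
    (seqShiftEquiv S)^[n] (shiftPath X t ω) = shiftPath X (t + n) ω := by
  induction n with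
  | zero => simp
  | succ n ih =>
    rw [Function.iterate_succ_apply', ih, seqShiftEquiv_shiftPath]
    push_cast
    rw [add_assoc]

theorem iterate_seqShiftEquiv_symm_shiftPath (X : ℤ → Ω → S) (t : ℤ) (ω : Ω) (n : ℕ) :
    (seqShiftEquiv S).symm^[n] (shiftPath X t ω) = shiftPath X (t - n) ω := by
  induction n with
  | zero => simp
  | succ n ih =>
    rw [Function.iterate_succ_apply', ih, seqShiftEquiv_symm_shiftPath]
    push_cast
    rw [sub_sub]

variable [MeasurableSpace Ω] [MeasurableSpace E] {μ : Measure Ω}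

theorem measurable_shiftPath {X : ℤ → Ω → S} (hX : ∀ t, Measurable (X t)) (t : ℤ) :
    Measurable (shiftPath X t) :=
  measurable_pi_lambda _ fun s => hX (s + t)

theorem ergodic_seqShiftEquiv {X : ℤ → Ω → S} (hX : IsStationaryErgodicProcess μ X) :
    Ergodic (seqShiftEquiv S) (μ.map (shiftPath X 0)) := by
  have h : shiftPath X 0 = fun ω t => X t ω := by ext ω t; simp [shiftPath]
  rw [h]; exact hX.2

theorem measurePreserving_shiftPath {X : ℤ → Ω → S} (hX : IsStationaryErgodicProcess μ X)
    (t : ℤ) : MeasurePreserving (shiftPath X t) μ (μ.map (shiftPath X 0)) := by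
  have hT := (ergodic_seqShiftEquiv hX).toMeasurePreserving
  induction t using Int.induction_on with
  | zero => exact ⟨measurable_shiftPath hX.1 0, rfl⟩
  | succ n ih =>
    refine (hT.comp ih).congr (measurable_shiftPath hX.1 _) ?_
    exact ae_of_all _ fun ω => seqShiftEquiv_shiftPath X n ω
  | pred n ih =>
    refine ((hT.symm (seqShiftEquiv S)).comp ih).congr (measurable_shiftPath hX.1 _) ?_
    exact ae_of_all _ fun ω => seqShiftEquiv_symm_shiftPath X (-n) ω

theorem ae_forall_shiftPath {X : ℤ → Ω → S} (hX : IsStationaryErgodicProcess μ X)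
    {Q : (ℤ → S) → Prop} (h : ∀ᵐ ξ ∂(μ.map (shiftPath X 0)), Q ξ) :
    ∀ᵐ ω ∂μ, ∀ t : ℤ, Q (shiftPath X t ω) :=
  ae_all_iff.2 fun t => (measurePreserving_shiftPath hX t).quasiMeasurePreserving.ae h

/-- Measurable functionals of the shifted paths of a stationary ergodic process form a stationary
ergodic process. -/
theorem IsStationaryErgodicProcess.comp_shiftPath {X : ℤ → Ω → S}
    (hX : IsStationaryErgodicProcess μ X) {V : (ℤ → S) → E} (hV : Measurable V) :
    IsStationaryErgodicProcess μ fun t ω => V (shiftPath X t ω) := by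
  refine ⟨fun t => hV.comp (measurable_shiftPath hX.1 t), ?_⟩
  set π : (ℤ → S) → ℤ → E := fun ξ t => V (shiftPath (fun s ξ => ξ s) t ξ) with hπ
  have hπm : Measurable π := measurable_pi_lambda _ fun t =>
    hV.comp (measurable_shiftPath (fun s => measurable_pi_apply s) t)
  have hmap : μ.map (fun ω t => V (shiftPath X t ω)) = (μ.map (shiftPath X 0)).map π := by
    rw [Measure.map_map hπm (measurable_shiftPath hX.1 0)]
    congr 1
    ext ω t
    change V (fun s => X (s + t) ω) = V (fun s => X (s + t + 0) ω)
    simp_rw [add_zero]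
  rw [hmap]
  have hmp : MeasurePreserving π (μ.map (shiftPath X 0)) ((μ.map (shiftPath X 0)).map π) :=
    ⟨hπm, rfl⟩
  -- `π` intertwines the two shifts, and a factor of an ergodic system is ergodic.
  refine hmp.ergodic_of_ergodic_semiconj (ergodic_seqShiftEquiv hX)
    (seqShiftEquiv E).measurable ?_
  intro ξ
  ext t
  change V (fun s => ξ (s + t + 1)) = V (fun s => ξ (s + (t + 1)))
  simp_rw [add_assoc]

theorem IsStationaryProcess.map_eq {Y : ℤ → Ω → S} (hY : IsStationaryProcess μ Y) (t : ℤ) :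
    μ.map (Y t) = μ.map (Y 0) := by
  have hm : Measurable fun ω t => Y t ω := measurable_pi_lambda _ hY.1
  have hstep : ∀ t, μ.map (Y (t + 1)) = μ.map (Y t) := by
    intro t
    have h1 := congrArg (Measure.map fun x : ℤ → S => x t) hY.2.map_eq
    rw [Measure.map_map (measurable_pi_apply t) hY.2.measurable,
      Measure.map_map ((measurable_pi_apply t).comp hY.2.measurable) hm,
      Measure.map_map (measurable_pi_apply t) hm] at h1
    exact h1
  induction t using Int.induction_on with
  | zero => rfl
  | succ n ih => rw [hstep, ih]
  | pred n ih => rw [← hstep, sub_add_cancel, ih]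

end Shift

/-! ### Backward iterates as functionals of the path -/

section Iterates

variable {Ω S E Θ : Type*}

theorem backIter_add (Ψ : ℤ → Ω → E → E) (ω : Ω) (n m : ℕ) (t : ℤ) (x : E) :
    backIter Ψ ω (n + m) t x = backIter Ψ ω n t (backIter Ψ ω m (t - n) x) := by
  induction n generalizing t with
  | zero => simp [backIter]
  | succ n ih =>
    rw [Nat.succ_add]
    simp only [backIter]
    rw [ih]
    push_cast
    rw [sub_sub, add_comm (1 : ℤ)]

theorem backIter_one (Ψ : ℤ → Ω → E → E) (ω : Ω) (t : ℤ) (x : E) :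
    backIter Ψ ω 1 t x = Ψ t ω x := rfl

theorem eq_backIter_of_recurrence {Ψ : ℤ → Ω → E → E} {ω : Ω} {u : ℤ → E} {s : ℤ}
    (h : ∀ t, s < t → u t = Ψ t ω (u (t - 1))) (n : ℕ) :
    ∀ t, s + n ≤ t → u t = backIter Ψ ω n t (u (t - n)) := by
  induction n with
  | zero => intro t _; simp [backIter]
  | succ n ih =>
    intro t ht
    push_cast at ht ⊢
    rw [backIter, h t (by omega), ih (t - 1) (by omega)]
    congr 2
    ring_nf

/-- The random maps `Ψ_t = G(X_{t + ·})` driven by the process `X`. -/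
def drivenMap (G : Θ → (ℤ → S) → E → E) (X : ℤ → Ω → S) (θ : Θ) (t : ℤ) (ω : Ω) : E → E :=
  G θ (shiftPath X t ω)

/-- The iterate `G(ξ) ∘ G(ξ_{· - 1}) ∘ ⋯` on path space. -/
def pathIter (G : (ℤ → S) → E → E) : ℕ → (ℤ → S) → E → E
  | 0, _, x => x
  | n + 1, ξ, x => G ξ (pathIter G n (fun s => ξ (s - 1)) x)

theorem backIter_drivenMap (G : Θ → (ℤ → S) → E → E) (X : ℤ → Ω → S) (θ : Θ) (ω : Ω) (n : ℕ)
    (t : ℤ) (x : E) :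
    backIter (drivenMap G X θ) ω n t x = pathIter (G θ) n (shiftPath X t ω) x := by
  induction n generalizing t with
  | zero => rfl
  | succ n ih =>
    rw [backIter, ih, pathIter, drivenMap]
    congr 2
    ext s
    change X (s + (t - 1)) ω = X (s - 1 + t) ω
    congr 1; ring

theorem measurable_pathIter [MeasurableSpace S] [MeasurableSpace E] {G : (ℤ → S) → E → E}
    (hG : Measurable fun z : (ℤ → S) × E => G z.1 z.2) (n : ℕ) :
    Measurable fun z : (ℤ → S) × E => pathIter G n z.1 z.2 := by
  induction n with
  | zero => exact measurable_snd
  | succ n ih =>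
    have hs : Measurable fun ξ : ℤ → S => fun s : ℤ => ξ (s - 1) :=
      measurable_pi_lambda _ fun s => measurable_pi_apply (s - 1)
    exact hG.comp (measurable_fst.prodMk (ih.comp ((hs.comp measurable_fst).prodMk measurable_snd)))

/-- The maps `Ψ θ t ω`, for a fixed `ω`, depend continuously on the parameter and are Lipschitz
uniformly in the parameter. -/
def RegularAt [MetricSpace E] [TopologicalSpace Θ] (Ψ : Θ → ℤ → Ω → E → E) (ω : Ω) : Prop :=
  ∀ t, ∃ C : ℝ≥0, (∀ θ, LipschitzWith C (Ψ θ t ω)) ∧ ∀ x, Continuous fun θ => Ψ θ t ω x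

variable [MetricSpace E] [TopologicalSpace Θ] {Ψ : Θ → ℤ → Ω → E → E} {ω : Ω}

theorem RegularAt.continuous_backIter (h : RegularAt Ψ ω) (n : ℕ) (t : ℤ) :
    Continuous fun z : Θ × E => backIter (Ψ z.1) ω n t z.2 := by
  induction n generalizing t with
  | zero => exact continuous_snd
  | succ n ih =>
    obtain ⟨C, hC, hc⟩ := h t
    have h1 : Continuous fun z : Θ × E => Ψ z.1 t ω z.2 :=
      continuous_prod_of_continuous_lipschitzWith' (fun z : Θ × E => Ψ z.1 t ω z.2) C
        (fun θ => hC θ) (fun x => hc x)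
    exact h1.comp (continuous_fst.prodMk (ih (t - 1)))

end Iterates

/-! ### Almost sure exponential contraction near a parameter -/

section Contraction

/-- For a fixed `ω`, the maps `Ψ θ t ω` with `θ ∈ B` contract exponentially fast, uniformly in
`θ ∈ B`, along forward solutions and along backward iterations. -/
structure IsContracting {Ω Θ E : Type*} [MetricSpace E] (Ψ : Θ → ℤ → Ω → E → E) (B : Set Θ)
    (y : E) (δ : ℝ) (ω : Ω) : Prop where
  forward : ∀ A ⊆ B, ∀ u v : ℤ → Θ → E,
    (∀ t : ℤ, 1 ≤ t → ∀ θ ∈ A, u t θ = Ψ θ t ω (u (t - 1) θ)) →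
    (∀ t : ℤ, 1 ≤ t → ∀ θ ∈ A, v t θ = Ψ θ t ω (v (t - 1) θ)) →
    ⨆ θ ∈ A, edist (u 0 θ) (v 0 θ) < ∞ →
    ∀ᶠ n : ℕ in atTop, ⨆ θ ∈ A, edist (u n θ) (v n θ) ≤ ENNReal.ofReal (Real.exp (-δ * n))
  backward : ∀ t : ℤ, ∀ᶠ n : ℕ in atTop, ∀ θ ∈ B, ∀ x x' : E,
    edist (backIter (Ψ θ) ω n t x) (backIter (Ψ θ) ω n t x') ≤
      ENNReal.ofReal (Real.exp (-δ * n)) * edist x x'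
  increments : ∀ t : ℤ, ∀ᶠ n : ℕ in atTop, ∀ θ ∈ B,
    edist (backIter (Ψ θ) ω n t y) (backIter (Ψ θ) ω (n + 1) t y) ≤
      ENNReal.ofReal (Real.exp (-δ * n))

variable {Ω S E Θ : Type*}

/-- The decaying sequence is the common Lipschitz coefficient over `B` of the `n`-fold iterates.
Each new map is innermost, so time runs backward from `t`. -/
theorem eventually_exp_of_dilation_le [MetricSpace E] {Ψ : Θ → ℤ → Ω → E → E} {B : Set Θ}
    {ω : Ω} {κ l : ℤ → ℝ≥0∞} {r : ℕ}
    (hκ : ∀ t, ∀ θ ∈ B, ∀ x x', edist (Ψ θ t ω x) (Ψ θ t ω x') ≤ κ t * edist x x')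
    (hl : ∀ t, ∀ θ ∈ B, ∀ x x', edist (backIter (Ψ θ) ω r t x) (backIter (Ψ θ) ω r t x') ≤
      l t * edist x x') {δ : ℝ} {t : ℤ}
    (hdec : ∀ d : ℕ → ℝ≥0∞, d 0 < ∞ → (∀ n : ℕ, d (n + 1) ≤ κ (t - n) * d n) →
      (∀ n : ℕ, d (n + r) ≤ l (t - n) * d n) →
      ∀ᶠ n : ℕ in atTop, d n ≤ ENNReal.ofReal (Real.exp (-δ * n))) :
    ∀ᶠ n : ℕ in atTop, ∀ θ ∈ B, ∀ x x' : E,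
      edist (backIter (Ψ θ) ω n t x) (backIter (Ψ θ) ω n t x') ≤
        ENNReal.ofReal (Real.exp (-δ * n)) * edist x x' := by
  have h := hdec (fun n => dilation B Set.univ fun θ x => backIter (Ψ θ) ω n t x) ?_ ?_ ?_
  · filter_upwards [h] with n hn θ hθ x x'
    exact (edist_le_dilation_mul (f := fun θ x => backIter (Ψ θ) ω n t x) hθ (Set.mem_univ x)
      (Set.mem_univ x')).trans (mul_le_mul_left hn _)
  · refine (dilation_le (c := 1) fun θ _ x _ y _ => ?_).trans_lt ENNReal.one_lt_top
    simp [backIter]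
  · intro n
    refine dilation_le fun θ hθ x _ x' _ => ?_
    rw [backIter_add, backIter_add, backIter_one, backIter_one]
    refine (edist_le_dilation_mul (f := fun θ x => backIter (Ψ θ) ω n t x) hθ (Set.mem_univ _)
      (Set.mem_univ _)).trans ?_
    rw [mul_comm (κ _), mul_assoc]
    exact mul_le_mul_right (hκ _ θ hθ x x') _
  · intro n
    refine dilation_le fun θ hθ x _ x' _ => ?_
    rw [backIter_add, backIter_add]
    refine (edist_le_dilation_mul (f := fun θ x => backIter (Ψ θ) ω n t x) hθ (Set.mem_univ _)
      (Set.mem_univ _)).trans ?_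
    rw [mul_comm (l _), mul_assoc]
    exact mul_le_mul_right (hl _ θ hθ x x') _

/-- The decaying sequence is the supremum over `B` of the distances. Each new map is outermost, so
time runs forward. -/
theorem eventually_exp_of_solutions [MetricSpace E] {Ψ : Θ → ℤ → Ω → E → E} {B : Set Θ}
    {ω : Ω} {κ l : ℤ → ℝ≥0∞} {r : ℕ}
    (hκ : ∀ t, ∀ θ ∈ B, ∀ x x', edist (Ψ θ t ω x) (Ψ θ t ω x') ≤ κ t * edist x x')
    (hl : ∀ t, ∀ θ ∈ B, ∀ x x', edist (backIter (Ψ θ) ω r t x) (backIter (Ψ θ) ω r t x') ≤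
      l t * edist x x') {δ : ℝ}
    (hdec : ∀ d : ℕ → ℝ≥0∞, d 0 < ∞ → (∀ n : ℕ, d (n + 1) ≤ κ (n + 1) * d n) →
      (∀ n : ℕ, d (n + r) ≤ l (n + r) * d n) →
      ∀ᶠ n : ℕ in atTop, d n ≤ ENNReal.ofReal (Real.exp (-δ * n)))
    {u v : ℤ → Θ → E} (hu : ∀ t : ℤ, 1 ≤ t → ∀ θ ∈ B, u t θ = Ψ θ t ω (u (t - 1) θ))
    (hv : ∀ t : ℤ, 1 ≤ t → ∀ θ ∈ B, v t θ = Ψ θ t ω (v (t - 1) θ))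
    (h0 : ⨆ θ ∈ B, edist (u 0 θ) (v 0 θ) < ∞) :
    ∀ᶠ n : ℕ in atTop, ⨆ θ ∈ B, edist (u n θ) (v n θ) ≤ ENNReal.ofReal (Real.exp (-δ * n)) := by
  have hle : ∀ (n : ℕ), ∀ θ ∈ B, edist (u n θ) (v n θ) ≤ ⨆ θ ∈ B, edist (u n θ) (v n θ) :=
    fun n θ hθ => le_iSup₂ (f := fun θ (_ : θ ∈ B) => edist (u n θ) (v n θ)) θ hθ
  refine hdec (fun n => ⨆ θ ∈ B, edist (u n θ) (v n θ)) (by simpa using h0) (fun n => ?_)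
    fun n => ?_
  · refine iSup₂_le fun θ hθ => ?_
    push_cast
    rw [hu _ (by omega) θ hθ, hv _ (by omega) θ hθ, add_sub_cancel_right]
    exact (hκ _ θ hθ _ _).trans (mul_le_mul_right (hle n θ hθ) _)
  · refine iSup₂_le fun θ hθ => ?_
    push_cast
    have hu' := eq_backIter_of_recurrence (Ψ := Ψ θ) (ω := ω) (u := fun t => u t θ) (s := 0)
      (fun t ht => hu t (by omega) θ hθ) r (n + r) (by omega)
    have hv' := eq_backIter_of_recurrence (Ψ := Ψ θ) (ω := ω) (u := fun t => v t θ) (s := 0)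
      (fun t ht => hv t (by omega) θ hθ) r (n + r) (by omega)
    rw [hu', hv', add_sub_cancel_right]
    exact (hl _ θ hθ _ _).trans (mul_le_mul_right (hle n θ hθ) _)

variable [MeasurableSpace Ω] [MeasurableSpace S] {μ : Measure Ω}
  [MetricSpace E] [MeasurableSpace E] [BorelSpace E] [SecondCountableTopology E]
  [MetricSpace Θ] [CompactSpace Θ] [IsProbabilityMeasure μ] {X : ℤ → Ω → S}
  {G : Θ → (ℤ → S) → E → E}

/-- The coefficient `Λ` need not be a function of the observations. It serves only to bound the
logarithmic moments of `L`, a functional of the path, to which the ergodic shift applies. -/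
theorem exists_ae_isContracting (hX : IsStationaryErgodicProcess μ X)
    (hG : ∀ θ, Measurable fun z : (ℤ → S) × E => G θ z.1 z.2)
    (hreg : ∀ᵐ ω ∂μ, RegularAt (drivenMap G X) ω)
    {r : ℕ} (hr : 0 < r) {Λ : Ω → Θ → ℝ≥0} (hΛm : ∀ θ, Measurable fun ω => Λ ω θ)
    (hΛ : ∀ᵐ ω ∂μ,
      SatisfiesCL (fun (x : E) (θ : Θ) => backIter (drivenMap G X θ) ω r 0 x) (Λ ω))
    (hΛsup : ∫⁻ ω, ⨆ θ, logPlus (Λ ω θ) ∂μ < ∞) {y : E}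
    (hy : ∫⁻ ω, ⨆ θ, logPlus (edist (drivenMap G X θ 0 ω y) y) ∂μ < ∞) {θ₁ : Θ}
    (hneg : NegativeLogMean μ fun ω => Λ ω θ₁) :
    ∃ ε : ℝ, 0 < ε ∧ ∃ δ : ℝ, 0 < δ ∧
      ∀ᵐ ω ∂μ, IsContracting (drivenMap G X) (Metric.closedBall θ₁ ε) y δ ω := by
  obtain ⟨ε, hε, hball⟩ := exists_closedBall_negativeLogMean hΛm
    (hΛ.mono fun ω h => h.1) hΛsup hneg
  refine ⟨ε, hε, ?_⟩
  set B := Metric.closedBall θ₁ ε with hB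
  set ν := μ.map (shiftPath X 0) with hν
  have hmp := measurePreserving_shiftPath hX
  have : IsProbabilityMeasure ν := Measure.isProbabilityMeasure_map (hmp 0).aemeasurable
  have hT := ergodic_seqShiftEquiv hX
  obtain ⟨B₀, hB₀B, hB₀c, hBB₀⟩ :=
    (TopologicalSpace.IsSeparable.of_separableSpace B).exists_countable_dense_subset
  obtain ⟨D, hDc, hDd⟩ := TopologicalSpace.exists_countable_dense E
  have hGx : ∀ θ x, Measurable fun ξ => G θ ξ x := fun θ x =>
    (hG θ).comp (measurable_id.prodMk measurable_const)
  have hGr : ∀ θ x, Measurable fun ξ => pathIter (G θ) r ξ x := fun θ x =>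
    (measurable_pathIter (hG θ) r).comp (measurable_id.prodMk measurable_const)
  set κ : (ℤ → S) → ℝ≥0∞ := fun ξ => dilation B₀ D fun θ x => G θ ξ x with hκdef
  set L : (ℤ → S) → ℝ≥0∞ := fun ξ => dilation B₀ D fun θ x => pathIter (G θ) r ξ x with hLdef
  set R : (ℤ → S) → ℝ≥0∞ := fun ξ => ⨆ θ ∈ B₀, edist (G θ ξ y) y with hRdef
  have hκm : Measurable κ := measurable_dilation hB₀c hDc hGx
  have hLm : Measurable L := measurable_dilation hB₀c hDc hGr
  have hRm : Measurable R := .biSup B₀ hB₀c fun θ _ => (hGx θ y).edist measurable_const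
  have hpL : Measurable fun ξ => logPlus (L ξ) := continuous_logPlus.measurable.comp hLm
  have hmL : Measurable fun ξ => logMinus (L ξ) := continuous_logMinus.measurable.comp hLm
  have hpR : Measurable fun ξ => logPlus (R ξ) := continuous_logPlus.measurable.comp hRm
  -- finiteness of the one-step coefficients
  have hκfin : ∀ᵐ ξ ∂ν, κ ξ < ∞ := by
    rw [hν, ae_map_iff (hmp 0).aemeasurable (measurableSet_lt hκm measurable_const)]
    filter_upwards [hreg] with ω hω
    obtain ⟨C, hC, -⟩ := hω 0
    exact (dilation_le fun θ _ x _ x' _ => hC θ x x').trans_lt ENNReal.coe_lt_top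
  -- the exponents of the `r`-step coefficients
  have hLΛ : ∀ᵐ ω ∂μ, L (shiftPath X 0 ω) ≤ ⨆ θ ∈ B, (Λ ω θ : ℝ≥0∞) := by
    filter_upwards [hΛ] with ω hω
    refine dilation_le fun θ hθ x _ x' _ => ?_
    rw [← backIter_drivenMap, ← backIter_drivenMap]
    exact (hω.2 θ x x').trans (mul_le_mul_left
      (le_iSup₂ (f := fun θ (_ : θ ∈ B) => (Λ ω θ : ℝ≥0∞)) θ (hB₀B hθ)) _)
  have hlp : ∫⁻ ξ, logPlus (L ξ) ∂ν ≤ ∫⁻ ω, logPlus (⨆ θ ∈ B, (Λ ω θ : ℝ≥0∞)) ∂μ := by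
    rw [hν, lintegral_map hpL (hmp 0).measurable]
    exact lintegral_mono_ae (hLΛ.mono fun ω h => monotone_logPlus h)
  have hlm : ∫⁻ ω, logMinus (⨆ θ ∈ B, (Λ ω θ : ℝ≥0∞)) ∂μ ≤ ∫⁻ ξ, logMinus (L ξ) ∂ν := by
    rw [hν, lintegral_map hmL (hmp 0).measurable]
    exact lintegral_mono_ae (hLΛ.mono fun ω h => antitone_logMinus h)
  obtain ⟨l, hl_meas, hl_int, hl_neg, hLl⟩ := exists_integrable_exponent hLm
    (hlp.trans_lt (hball.trans_le le_top)) (hlp.trans_lt (hball.trans_le hlm))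
  -- logarithmic growth of the distances to the reference point
  have hRint : ∫⁻ ξ, logPlus (R ξ) ∂ν < ∞ := by
    rw [hν, lintegral_map hpR (hmp 0).measurable]
    refine (lintegral_mono fun ω => ?_).trans_lt hy
    exact (monotone_logPlus (iSup_mono fun θ => iSup_const_le)).trans
      (monotone_logPlus.map_iSup_of_continuousAt continuous_logPlus.continuousAt
        (by simp [logPlus])).le
  have hRlm : Measurable fun ξ => (logPlus (R ξ)).toReal :=
    hpR.ennreal_toReal
  have hRl : Integrable (fun ξ => (logPlus (R ξ)).toReal) ν :=
    integrable_toReal_of_lintegral_ne_top hpR.aemeasurable hRint.ne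
  have hRfin : ∀ᵐ ξ ∂ν, R ξ < ∞ :=
    (ae_lt_top hpR hRint.ne).mono
      fun ξ h => logPlus_lt_top_iff.1 h
  -- decay forward and backward in time
  have hTr : MeasurePreserving (seqShiftEquiv S)^[r - 1] ν ν := hT.toMeasurePreserving.iterate _
  obtain ⟨δ₁, hδ₁, hforw⟩ := ae_eventually_le_exp_of_ergodic hT hκm hκfin
    (l := fun ξ => l ((seqShiftEquiv S)^[r - 1] ξ)) (hl_meas.comp hTr.measurable)
    (hTr.integrable_comp_of_integrable hl_int) (by
      have h1 := integral_map hTr.aemeasurable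
        (f := l) (by rw [hTr.map_eq]; exact hl_int.aestronglyMeasurable)
      rw [hTr.map_eq] at h1
      rwa [← h1]) hr
  obtain ⟨δ₂, hδ₂, hback⟩ := ae_eventually_le_exp_of_ergodic hT.symm hκm hκfin hl_meas hl_int
    hl_neg hr
  have hgrow := ae_comp_iterate_le hT.symm hRlm hRl (half_pos hδ₂)
  -- For the increments, the rate `δ₂` loses half to the growth of the distances to `y` and a
  -- quarter to a constant.
  refine ⟨min δ₁ (δ₂ / 4), lt_min hδ₁ (by positivity), ?_⟩
  have hexp : ∀ {a : ℝ} (n : ℕ), min δ₁ (δ₂ / 4) ≤ a → ENNReal.ofReal (Real.exp (-a * n)) ≤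
      ENNReal.ofReal (Real.exp (-min δ₁ (δ₂ / 4) * n)) := fun n ha =>
    ENNReal.ofReal_le_ofReal (Real.exp_le_exp.2
      (mul_le_mul_of_nonneg_right (neg_le_neg ha) n.cast_nonneg))
  filter_upwards [hreg, ae_forall_shiftPath hX hLl, ae_forall_shiftPath hX hRfin,
    ae_forall_shiftPath hX hforw, ae_forall_shiftPath hX hback, ae_forall_shiftPath hX hgrow]
    with ω hω hLω hRω hfω hbω hgω
  have hκω : ∀ t, ∀ θ ∈ B, ∀ x x', edist (drivenMap G X θ t ω x) (drivenMap G X θ t ω x') ≤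
      κ (shiftPath X t ω) * edist x x' := by
    intro t θ hθ x x'
    obtain ⟨C, hC, hc⟩ := hω t
    exact edist_le_dilation_mul_of_dense (f := fun θ x => drivenMap G X θ t ω x) hBB₀ hDd hc
      (fun θ => (hC θ).continuous) hθ x x'
  have hlω : ∀ t, ∀ θ ∈ B, ∀ x x', edist (backIter (drivenMap G X θ) ω r t x)
      (backIter (drivenMap G X θ) ω r t x') ≤
      ENNReal.ofReal (Real.exp (l (shiftPath X t ω))) * edist x x' := by
    intro t θ hθ x x'
    have hcont := hω.continuous_backIter r t
    have h1 := edist_le_dilation_mul_of_dense (f := fun θ x => backIter (drivenMap G X θ) ω r t x)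
      hBB₀ hDd (fun x => hcont.comp (Continuous.prodMk_left x))
      (fun θ => hcont.comp (Continuous.prodMk_right θ)) hθ x x'
    refine h1.trans (mul_le_mul_left (le_trans (le_of_eq ?_) (hLω t)) _)
    simp only [hLdef, backIter_drivenMap]
  have hbackω : ∀ t : ℤ, ∀ᶠ n : ℕ in atTop, ∀ θ ∈ B, ∀ x x' : E,
      edist (backIter (drivenMap G X θ) ω n t x) (backIter (drivenMap G X θ) ω n t x') ≤
        ENNReal.ofReal (Real.exp (-δ₂ * n)) * edist x x' := fun t =>
    eventually_exp_of_dilation_le hκω hlω (by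
      have := hbω t
      simpa only [iterate_seqShiftEquiv_symm_shiftPath] using this)
  refine ⟨fun A hA u v hu hv h0 => ?_, fun t => ?_, fun t => ?_⟩
  · have h := eventually_exp_of_solutions (B := A) (fun t θ hθ => hκω t θ (hA hθ))
      (fun t θ hθ => hlω t θ (hA hθ)) (δ := δ₁) (fun d hd0 hd1 hdr => by
      refine hfω 1 d hd0 (fun n => ?_) fun n => ?_
      · rw [iterate_seqShiftEquiv_shiftPath, add_comm (1 : ℤ)]
        exact hd1 n
      · rw [iterate_seqShiftEquiv_shiftPath, iterate_seqShiftEquiv_shiftPath]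
        convert hdr n using 6
        omega) hu hv h0
    filter_upwards [h] with n hn using hn.trans (hexp n (min_le_left _ _))
  · filter_upwards [hbackω t] with n hn θ hθ x x'
    exact (hn θ hθ x x').trans (mul_le_mul_left
      (hexp n ((min_le_right _ _).trans (by linarith))) _)
  · obtain ⟨C, hC⟩ := hgω t
    have hev : ∀ᶠ n : ℕ in atTop, C / (δ₂ / 4) ≤ n :=
      (tendsto_natCast_atTop_atTop (R := ℝ)).eventually_ge_atTop _
    filter_upwards [hbackω t, hev] with n hn hn' θ hθ
    rw [backIter_add, backIter_one]
    refine (hn θ hθ _ _).trans (le_trans ?_ (hexp n (min_le_right _ _)))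
    have hRn : edist y (drivenMap G X θ (t - n) ω y) ≤ R (shiftPath X (t - n) ω) := by
      rw [edist_comm]
      obtain ⟨K, -, hc⟩ := hω (t - n)
      exact (le_iSup₂ (f := fun θ (_ : θ ∈ B) => edist (drivenMap G X θ (t - n) ω y) y) θ hθ).trans
        (biSup_le_biSup_of_subset_closure ((hc y).edist continuous_const) hBB₀)
    have hCn := hC n
    rw [iterate_seqShiftEquiv_symm_shiftPath] at hCn
    calc _ ≤ ENNReal.ofReal (Real.exp (-δ₂ * n)) *
          ENNReal.ofReal (Real.exp (logPlus (R (shiftPath X (t - n) ω))).toReal) :=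
          mul_le_mul_right (hRn.trans (le_exp_logPlus (hRω _))) _
      _ ≤ ENNReal.ofReal (Real.exp (-(δ₂ / 4) * n)) := by
          rw [← ENNReal.ofReal_mul (Real.exp_pos _).le, ← Real.exp_add]
          refine ENNReal.ofReal_le_ofReal (Real.exp_le_exp.2 ?_)
          rw [div_le_iff₀ (by positivity)] at hn'
          linarith

end Contraction

/-! ### Limits of backward iterates -/

section BackwardLimit

variable {Ω Θ E : Type*} [MetricSpace E] {Ψ : Θ → ℤ → Ω → E → E} {B : Set Θ} {y : E} {δ : ℝ}
  {ω : Ω}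

theorem tendsto_ofReal_exp_neg_mul (hδ : 0 < δ) :
    Tendsto (fun n : ℕ => ENNReal.ofReal (Real.exp (-δ * n))) atTop (𝓝 0) := by
  rw [← ENNReal.ofReal_zero]
  refine ENNReal.tendsto_ofReal (Real.tendsto_exp_atBot.comp ?_)
  exact tendsto_natCast_atTop_atTop.const_mul_atTop_of_neg (neg_lt_zero.2 hδ)

/-- The increments lie below one geometric sequence for all `θ ∈ B`, so the tails are bounded
uniformly. -/
theorem exists_tendsto_of_edist_le_exp {f : ℕ → Θ → E} [CompleteSpace E] (hδ : 0 < δ)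
    (hf : ∀ᶠ n : ℕ in atTop, ∀ θ ∈ B,
      edist (f n θ) (f (n + 1) θ) ≤ ENNReal.ofReal (Real.exp (-δ * n))) :
    (∀ θ ∈ B, ∃ a, Tendsto (fun n => f n θ) atTop (𝓝 a)) ∧
      ∀ a : Θ → E, (∀ θ ∈ B, Tendsto (fun n => f n θ) atTop (𝓝 (a θ))) →
        TendstoUniformlyOn f a atTop B := by
  obtain ⟨N, hN⟩ := eventually_atTop.1 hf
  set ρ : ℝ≥0∞ := ENNReal.ofReal (Real.exp (-δ)) with hρ
  have hρ1 : ρ < 1 := by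
    rw [hρ, ENNReal.ofReal_lt_one, Real.exp_lt_one_iff]; linarith
  have hstep : ∀ θ ∈ B, ∀ n, edist (f (n + N) θ) (f (n + 1 + N) θ) ≤ 1 * ρ ^ n := by
    intro θ hθ n
    have h1 := hN (n + N) (by omega) θ hθ
    rw [show n + 1 + N = n + N + 1 by ring, one_mul, hρ, ← ENNReal.ofReal_pow (Real.exp_pos _).le,
      ← Real.exp_nat_mul]
    refine h1.trans (ENNReal.ofReal_le_ofReal (Real.exp_le_exp.2 ?_))
    push_cast
    nlinarith [mul_nonneg hδ.le (Nat.cast_nonneg (α := ℝ) N)]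
  constructor
  · intro θ hθ
    obtain ⟨a, ha⟩ := cauchySeq_tendsto_of_complete
      (cauchySeq_of_edist_le_geometric ρ 1 hρ1 ENNReal.one_ne_top (hstep θ hθ))
    exact ⟨a, (tendsto_add_atTop_iff_nat (f := fun n => f n θ) N).1 ha⟩
  · intro a ha
    rw [EMetric.tendstoUniformlyOn_iff]
    intro ε hε
    have hlim : Tendsto (fun n : ℕ => 1 * ρ ^ n / (1 - ρ)) atTop (𝓝 0) := by
      have h1 : Tendsto (fun n : ℕ => 1 * ρ ^ n) atTop (𝓝 0) := by
        simpa using ENNReal.tendsto_pow_atTop_nhds_zero_of_lt_one hρ1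
      have h2 := ENNReal.Tendsto.div_const h1 (b := 1 - ρ) (Or.inr (tsub_pos_iff_lt.2 hρ1).ne')
      rwa [ENNReal.zero_div] at h2
    obtain ⟨M, hM⟩ := eventually_atTop.1 (hlim.eventually_lt_const hε)
    filter_upwards [eventually_ge_atTop (M + N)] with n hn θ hθ
    obtain ⟨i, rfl⟩ : ∃ i, n = i + N := ⟨n - N, by omega⟩
    rw [edist_comm]
    exact (edist_le_of_edist_le_geometric_of_tendsto ρ 1 (hstep θ hθ)
      ((tendsto_add_atTop_iff_nat (f := fun n => f n θ) N).2 (ha θ hθ)) i).trans_lt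
      (hM i (by omega))

theorem eq_of_tendsto_backIter {θ : Θ} {Y : ℤ → E}
    (hY : ∀ t, Tendsto (fun n => backIter (Ψ θ) ω n t y) atTop (𝓝 (Y t)))
    (hc : ∀ t, Continuous (Ψ θ t ω)) (t : ℤ) : Y t = Ψ θ t ω (Y (t - 1)) := by
  have h1 := (tendsto_add_atTop_iff_nat (f := fun n => backIter (Ψ θ) ω n t y) 1).2 (hY t)
  exact tendsto_nhds_unique h1 (((hc t).tendsto _).comp (hY (t - 1)))

/-- For a fixed `ω`, the maps contract exponentially fast near each value of the parameter. -/
def IsLocallyContracting [TopologicalSpace Θ] (Ψ : Θ → ℤ → Ω → E → E) (y : E) (ω : Ω) : Prop :=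
  ∀ θ, ∃ B ∈ 𝓝 θ, ∃ δ : ℝ, 0 < δ ∧ IsContracting Ψ B y δ ω

variable [TopologicalSpace Θ] [CompleteSpace E]

theorem IsLocallyContracting.exists_tendsto (h : IsLocallyContracting Ψ y ω) (θ : Θ) (t : ℤ) :
    ∃ a, Tendsto (fun n => backIter (Ψ θ) ω n t y) atTop (𝓝 a) := by
  obtain ⟨B, hB, δ, hδ, hc⟩ := h θ
  exact (exists_tendsto_of_edist_le_exp (f := fun n θ => backIter (Ψ θ) ω n t y) hδ
    (hc.increments t)).1 θ (mem_of_mem_nhds hB)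

theorem IsLocallyContracting.continuous_limit (h : IsLocallyContracting Ψ y ω)
    (hreg : RegularAt Ψ ω) {t : ℤ} {a : Θ → E}
    (ha : ∀ θ, Tendsto (fun n => backIter (Ψ θ) ω n t y) atTop (𝓝 (a θ))) : Continuous a := by
  refine continuous_iff_continuousAt.2 fun θ => ?_
  obtain ⟨B, hB, δ, hδ, hc⟩ := h θ
  have hu := (exists_tendsto_of_edist_le_exp (f := fun n θ => backIter (Ψ θ) ω n t y) hδ
    (hc.increments t)).2 a fun θ _ => ha θ
  have hcont : ∀ n, Continuous fun θ => backIter (Ψ θ) ω n t y := fun n =>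
    (hreg.continuous_backIter n t).comp (Continuous.prodMk_left y)
  exact (hu.continuousOn
    (Eventually.of_forall fun n => (hcont n).continuousOn).frequently).continuousAt hB

end BackwardLimit

/-! ### Measurability with respect to the past maps -/

section Measurability

variable {Ω E : Type*} [MetricSpace E]

variable {m₀ m : MeasurableSpace Ω} {μ : Measure[m₀] Ω} [CompleteSpace E]

/-- `limUnder` of the representatives is measurable for `m` and defined everywhere, so the null set
of divergence need not belong to `m`. -/
theorem aestronglyMeasurable_of_ae_tendsto {f : ℕ → Ω → E} {g : Ω → E}
    (hf : ∀ n, AEStronglyMeasurable[m] (f n) μ)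
    (hg : ∀ᵐ ω ∂μ, Tendsto (fun n => f n ω) atTop (𝓝 (g ω))) : AEStronglyMeasurable[m] g μ := by
  rcases isEmpty_or_nonempty E with hE | hE
  · have : IsEmpty Ω := ⟨fun ω => hE.elim (g ω)⟩
    exact ⟨g, StronglyMeasurable.of_discrete, Filter.EventuallyEq.rfl⟩
  refine ⟨fun ω => limUnder atTop fun n => (hf n).mk (f n) ω,
    StronglyMeasurable.limUnder fun n => (hf n).stronglyMeasurable_mk, ?_⟩
  filter_upwards [hg, ae_all_iff.2 fun n => (hf n).ae_eq_mk] with ω h1 h2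
  refine (Tendsto.limUnder_eq ?_).symm
  simpa only [← h2] using h1

/-- The σ-algebra of the past maps only sees their values at fixed points. Simple approximations of
`U` reduce the composition to such values, and continuity passes to the limit. -/
theorem aestronglyMeasurable_apply [MeasurableSpace E] [BorelSpace E] [SecondCountableTopology E]
    {F : Ω → E → E} (hF : ∀ x, Measurable[m] fun ω => F ω x) (hc : ∀ᵐ ω ∂μ, Continuous (F ω))
    {U : Ω → E} (hU : AEStronglyMeasurable[m] U μ) :
    AEStronglyMeasurable[m] (fun ω => F ω (U ω)) μ := by
  obtain ⟨V, hV, hUV⟩ := hU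
  refine aestronglyMeasurable_of_ae_tendsto (f := fun n ω => F ω (hV.approx n ω)) (fun n => ?_) ?_
  · have h1 : Measurable[m] fun ω => F ω (hV.approx n ω) :=
      SimpleFunc.measurable_bind (hV.approx n) (fun x ω => F ω x) hF
    exact ⟨_, h1.stronglyMeasurable, Filter.EventuallyEq.rfl⟩
  · filter_upwards [hc, hUV] with ω h1 h2
    rw [h2]
    exact (h1.tendsto _).comp (hV.tendsto_approx ω)

end Measurability

/-! ### Convergence, uniqueness and attraction -/

section Convergence

variable {Ω Θ E : Type*} [MeasurableSpace Ω] {μ : Measure Ω}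

theorem expAlmostSurely_of_eventually_le {u : ℤ → Ω → ℝ≥0∞} {δ : ℝ} (hδ : 0 < δ)
    (h : ∀ᵐ ω ∂μ, ∀ᶠ n : ℕ in atTop, u n ω ≤ ENNReal.ofReal (Real.exp (-δ * n))) :
    ExpAlmostSurely μ u := by
  refine ⟨δ / 2, half_pos hδ, ?_⟩
  filter_upwards [h] with ω hω
  have h1 : Tendsto (fun n : ℕ => ENNReal.ofReal (Real.exp (δ / 2 * n)) * u n ω) atTop (𝓝 0) := by
    refine tendsto_of_tendsto_of_tendsto_of_le_of_le' tendsto_const_nhds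
      (tendsto_ofReal_exp_neg_mul (half_pos hδ)) (Eventually.of_forall fun n => zero_le) ?_
    filter_upwards [hω] with n hn
    refine (mul_le_mul_right hn _).trans (le_of_eq ?_)
    rw [← ENNReal.ofReal_mul (Real.exp_pos _).le, ← Real.exp_add]
    ring_nf
  have h2 : Tendsto Int.toNat atTop atTop :=
    tendsto_atTop.2 fun n => (eventually_ge_atTop (n : ℤ)).mono fun t ht => by omega
  refine (h1.comp h2).congr' ?_
  filter_upwards [eventually_ge_atTop 0] with t ht
  have h3 : ((t.toNat : ℕ) : ℤ) = t := Int.toNat_of_nonneg ht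
  have h4 : ((t.toNat : ℕ) : ℝ) = (t : ℝ) := by exact_mod_cast h3
  simp only [Function.comp_apply, h3, h4]

variable [MetricSpace E] [MeasurableSpace E] [BorelSpace E] [SecondCountableTopology E]

/-- Stationary processes return to bounded sets along any half line of times. -/
theorem ae_exists_frequently_le [IsProbabilityMeasure μ] {Y Z : ℤ → Ω → E}
    (hY : IsStationaryProcess μ Y) (hZ : IsStationaryProcess μ Z) (y : E) (t : ℤ) :
    ∀ᵐ ω ∂μ, ∃ K : ℕ, ∃ᶠ n : ℕ in atTop,
      edist (Y (t - n) ω) y ≤ K ∧ edist (Z (t - n) ω) y ≤ K := by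
  set tail : (ℤ → Ω → E) → ℕ → ℝ≥0∞ := fun W K => μ {ω | (K : ℝ≥0∞) < edist (W 0 ω) y} with htail
  have hS : ∀ K : ℕ, MeasurableSet {x : E | (K : ℝ≥0∞) < edist x y} := fun K =>
    measurableSet_lt measurable_const (measurable_id.edist measurable_const)
  have htail0 : ∀ W : ℤ → Ω → E, (∀ t, Measurable (W t)) →
      Tendsto (tail W) atTop (𝓝 0) := by
    intro W hW
    have h1 := tendsto_measure_iInter_atTop (μ := μ)
      (s := fun K : ℕ => {ω | (K : ℝ≥0∞) < edist (W 0 ω) y})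
      (fun K => ((hW 0) (hS K)).nullMeasurableSet)
      (fun i j hij ω hω => lt_of_le_of_lt (Nat.cast_le.2 hij : (i : ℝ≥0∞) ≤ j) hω) 
      ⟨0, measure_ne_top _ _⟩
    have h2 : ⋂ K : ℕ, {ω | (K : ℝ≥0∞) < edist (W 0 ω) y} = ∅ := by
      refine Set.eq_empty_of_forall_notMem fun ω hω => ?_
      obtain ⟨K, hK⟩ := ENNReal.exists_nat_gt (edist_ne_top (W 0 ω) y)
      exact absurd (Set.mem_iInter.1 hω K) (not_lt.2 hK.le)
    rwa [h2, measure_empty] at h1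
  have heq : ∀ W : ℤ → Ω → E, IsStationaryProcess μ W → ∀ (s : ℤ) (K : ℕ),
      μ {ω | (K : ℝ≥0∞) < edist (W s ω) y} = tail W K := by
    intro W hW s K
    have h1 := congrArg (fun ν => ν {x : E | (K : ℝ≥0∞) < edist x y}) (hW.map_eq s)
    rwa [Measure.map_apply (hW.1 s) (hS K), Measure.map_apply (hW.1 0) (hS K)] at h1
  have hsum : Tendsto (fun K => tail Y K + tail Z K) atTop (𝓝 0) := by
    simpa using (htail0 Y hY.1).add (htail0 Z hZ.1)
  rw [ae_iff]
  -- If no level works, then for each `K` one of the two processes exceeds `K` at all sufficiently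
  -- remote times. By stationarity this has probability at most the sum of the two tails.
  refine le_antisymm (ge_of_tendsto' hsum fun K => ?_) zero_le
  calc μ {ω | ¬∃ K : ℕ, ∃ᶠ n : ℕ in atTop, edist (Y (t - n) ω) y ≤ K ∧ edist (Z (t - n) ω) y ≤ K}
      ≤ μ (⋃ N : ℕ, ⋂ n ≥ N, {ω | (K : ℝ≥0∞) < edist (Y (t - n) ω) y} ∪
          {ω | (K : ℝ≥0∞) < edist (Z (t - n) ω) y}) := by
        refine measure_mono fun ω hω => ?_
        have h1 : ¬∃ᶠ n : ℕ in atTop, edist (Y (t - n) ω) y ≤ K ∧ edist (Z (t - n) ω) y ≤ K :=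
          fun h => hω ⟨K, h⟩
        rw [not_frequently, eventually_atTop] at h1
        obtain ⟨N, hN⟩ := h1
        refine Set.mem_iUnion.2 ⟨N, Set.mem_iInter₂.2 fun n hn => ?_⟩
        rcases not_and_or.1 (hN n hn) with h | h
        · exact Or.inl (not_le.1 h)
        · exact Or.inr (not_le.1 h)
    _ = ⨆ N : ℕ, μ (⋂ n ≥ N, {ω | (K : ℝ≥0∞) < edist (Y (t - n) ω) y} ∪
          {ω | (K : ℝ≥0∞) < edist (Z (t - n) ω) y}) := by
        refine Monotone.measure_iUnion fun i j hij => ?_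
        exact Set.biInter_subset_biInter_left fun n (hn : j ≤ n) => hij.trans hn
    _ ≤ tail Y K + tail Z K := by
        refine iSup_le fun N => (measure_mono (Set.biInter_subset_of_mem (le_refl N))).trans ?_
        refine (measure_union_le _ _).trans (le_of_eq ?_)
        rw [heq Y hY, heq Z hZ]

variable [CompleteSpace E]

theorem isConvergentSRE_of_isContracting [IsProbabilityMeasure μ] {Ψ : Θ → ℤ → Ω → E → E}
    {B : Set Θ} {θ : Θ} (hθ : θ ∈ B) {y : E} {δ : ℝ} (hδ : 0 < δ)
    (hcontr : ∀ᵐ ω ∂μ, IsContracting Ψ B y δ ω) (hcont : ∀ᵐ ω ∂μ, ∀ t, Continuous (Ψ θ t ω))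
    {Y : ℤ → Ω → E} (hY : IsStationaryErgodicProcess μ Y)
    (hlim : ∀ᵐ ω ∂μ, ∀ t, Tendsto (fun n => backIter (Ψ θ) ω n t y) atTop (𝓝 (Y t ω))) :
    IsConvergentSRE μ (Ψ θ) Y := by
  have hYs : IsStationaryProcess μ Y := ⟨hY.1, hY.2.toMeasurePreserving⟩
  have hsol : ∀ᵐ ω ∂μ, ∀ t, Y t ω = Ψ θ t ω (Y (t - 1) ω) := by
    filter_upwards [hlim, hcont] with ω h1 h2
    exact eq_of_tendsto_backIter (Y := fun t => Y t ω) h1 h2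
  have hlim' : ∀ (x : E) (t : ℤ), ∀ᵐ ω ∂μ,
      Tendsto (fun n : ℕ => backIter (Ψ θ) ω n t x) atTop (𝓝 (Y t ω)) := by
    intro x t
    filter_upwards [hlim, hcontr] with ω h1 h2
    have h3 : Tendsto (fun n : ℕ => ENNReal.ofReal (Real.exp (-δ * n)) * edist x y) atTop
        (𝓝 0) := by
      simpa using ENNReal.Tendsto.mul_const (tendsto_ofReal_exp_neg_mul hδ)
        (Or.inr (edist_ne_top x y))
    have h4 : Tendsto (fun n : ℕ => edist (backIter (Ψ θ) ω n t y) (backIter (Ψ θ) ω n t x)) atTop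
        (𝓝 0) :=
      tendsto_of_tendsto_of_tendsto_of_le_of_le' tendsto_const_nhds h3
        (Eventually.of_forall fun n => zero_le)
        ((h2.backward t).mono fun n hn => by rw [edist_comm]; exact hn θ hθ x y)
    refine (tendsto_iff_of_dist ?_).1 (h1 t)
    simpa [Function.comp_def, edist_dist, dist_nonneg] using
      (ENNReal.tendsto_toReal ENNReal.zero_ne_top).comp h4
  refine ⟨hY, hsol, fun Y' hY' hsol' => ?_, fun x t => ?_, fun t => ?_, fun Y' hsol' => ?_⟩
  -- Uniqueness without moments: at arbitrarily remote times both solutions are within `K` of `y`,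
  -- so their distance at `t` is at most `2 * K * exp (-δ * n)` for arbitrarily large `n`.
  · refine ae_all_iff.2 fun t => ?_
    filter_upwards [hsol, hsol', hcontr, ae_exists_frequently_le hY' hYs y t] with ω h1 h2 h3
      ⟨K, hK⟩
    by_contra hne
    have hpos : 0 < edist (Y' t ω) (Y t ω) := edist_pos.2 hne
    have h4 : Tendsto (fun n : ℕ => ENNReal.ofReal (Real.exp (-δ * n)) * (K + K : ℝ≥0∞)) atTop
        (𝓝 0) := by
      simpa using ENNReal.Tendsto.mul_const (b := (K + K : ℝ≥0∞)) (tendsto_ofReal_exp_neg_mul hδ)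
        (Or.inr (by finiteness))
    obtain ⟨n, ⟨hn1, hn2⟩, hn3, hn4⟩ := (hK.and_eventually
      ((h3.backward t).and (h4.eventually_lt_const hpos))).exists
    refine absurd hn4 (not_lt.2 ?_)
    have e1 := eq_backIter_of_recurrence (Ψ := Ψ θ) (u := fun t => Y' t ω) (s := t - n)
      (fun t _ => h2 t) n t (by omega)
    have e2 := eq_backIter_of_recurrence (Ψ := Ψ θ) (u := fun t => Y t ω) (s := t - n)
      (fun t _ => h1 t) n t (by omega)
    rw [show Y' t ω = _ from e1, show Y t ω = _ from e2]
    refine (hn3 θ hθ _ _).trans (mul_le_mul_right ?_ _)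
    exact (edist_triangle_right _ _ y).trans (add_le_add hn1 hn2)
  · filter_upwards [hlim' x t] with ω h
    exact (tendsto_add_atTop_iff_nat (f := fun n => backIter (Ψ θ) ω n t x) 1).2 h
  · have hm : ∀ s ≤ t, ∀ x, Measurable[mapsSigmaAlgebra (Ψ θ) t] fun ω => Ψ θ s ω x :=
      fun s hs x => measurable_iff_comap_le.2
        (le_iSup_of_le s (le_iSup_of_le hs (le_iSup_of_le x le_rfl)))
    have hit : ∀ (n : ℕ), ∀ s ≤ t, AEStronglyMeasurable[mapsSigmaAlgebra (Ψ θ) t]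
        (fun ω => backIter (Ψ θ) ω n s y) μ := by
      intro n
      induction n with
      | zero => exact fun s _ => ⟨_, stronglyMeasurable_const, Filter.EventuallyEq.rfl⟩
      | succ n ih =>
        intro s hs
        exact aestronglyMeasurable_apply (hm s hs) (hcont.mono fun ω h => h s)
          (ih (s - 1) (by omega))
    exact aestronglyMeasurable_of_ae_tendsto (fun n => hit n t le_rfl) (hlim' y t)
  · refine expAlmostSurely_of_eventually_le hδ ?_
    filter_upwards [hsol, hsol', hcontr] with ω h1 h2 h3
    have h4 := h3.forward {θ} (Set.singleton_subset_iff.2 hθ) (fun t _ => Y' t ω) (fun t _ => Y t ω)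
      (fun t ht θ' hθ' => by rw [Set.mem_singleton_iff.1 hθ']; exact h2 t ht)
      (fun t ht θ' hθ' => by rw [Set.mem_singleton_iff.1 hθ']; exact h1 t)
      (by simpa using edist_lt_top _ _)
    simpa using h4

end Convergence

/-! ### Compactness, blocks and the volatility model -/

theorem ExpAlmostSurely.of_le_const_mul {Ω : Type*} [MeasurableSpace Ω] {μ : Measure Ω}
    {u w : ℤ → Ω → ℝ≥0∞} (hu : ExpAlmostSurely μ u) (K : ℝ≥0)
    (h : ∀ t ω, w t ω ≤ K * u t ω) : ExpAlmostSurely μ w := by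
  obtain ⟨C, hC, hlim⟩ := hu
  refine ⟨C, hC, hlim.mono fun ω hω => ?_⟩
  have h1 := ENNReal.Tendsto.const_mul (a := (K : ℝ≥0∞)) hω (Or.inr ENNReal.coe_ne_top)
  rw [mul_zero] at h1
  refine tendsto_of_tendsto_of_tendsto_of_le_of_le tendsto_const_nhds h1 (fun t => zero_le)
    fun t => ?_
  rw [mul_left_comm]
  exact mul_le_mul_right (h t ω) _

/-- Finitely many balls cover `Θ`, so a single null set serves all parameters. -/
theorem ae_isLocallyContracting {Ω Θ E : Type*} [MeasurableSpace Ω] {μ : Measure Ω}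
    [MetricSpace E] [MetricSpace Θ] [CompactSpace Θ] {Ψ : Θ → ℤ → Ω → E → E} {y : E}
    (h : ∀ θ, ∃ ε : ℝ, 0 < ε ∧ ∃ δ : ℝ, 0 < δ ∧
      ∀ᵐ ω ∂μ, IsContracting Ψ (Metric.closedBall θ ε) y δ ω) :
    ∀ᵐ ω ∂μ, IsLocallyContracting Ψ y ω := by
  choose ε hε δ hδ hc using h
  obtain ⟨s, -, hs⟩ := isCompact_univ.elim_nhds_subcover (fun θ : Θ => Metric.ball θ (ε θ))
    fun θ _ => Metric.ball_mem_nhds θ (hε θ)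
  filter_upwards [(ae_ball_iff s.countable_toSet).2 fun θ _ => hc θ] with ω hω θ
  obtain ⟨θ', hθ', hmem⟩ := Set.mem_iUnion₂.1 (hs (Set.mem_univ θ))
  exact ⟨_, mem_of_superset (Metric.isOpen_ball.mem_nhds hmem) Metric.ball_subset_closedBall,
    δ θ', hδ θ', hω θ' hθ'⟩

theorem regularAt_of_satisfiesCL {Ω Θ E : Type*} [MetricSpace E] [MetricSpace Θ] [CompactSpace Θ]
    {Ψ : Θ → ℤ → Ω → E → E} {ω : Ω} (hc : ∀ t x, Continuous fun θ => Ψ θ t ω x)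
    (hΛ : ∀ t, ∃ Λ : Θ → ℝ≥0, SatisfiesCL (fun x θ => Ψ θ t ω x) Λ) : RegularAt Ψ ω := by
  intro t
  obtain ⟨Λ, hΛc, hΛl⟩ := hΛ t
  obtain ⟨C, hC⟩ := (isCompact_range hΛc).bddAbove
  exact ⟨C, fun θ => (hΛl θ).weaken (hC (Set.mem_range_self θ)), hc t⟩

namespace VolatilityModel

theorem block_last {H : Type*} {p : ℕ} (hp : 1 ≤ p) (g : ℤ → H) (t : ℤ) :
    block p g t ⟨p - 1, by omega⟩ = g t := by
  simp only [block]
  congr 1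
  push_cast [Nat.cast_sub hp]
  ring

/-- Each step shifts the coordinates, so coordinate `i` at time `t` was the last one `p - 1 - i`
steps earlier. -/
theorem block_eq_of_pushBlock {H : Type*} {p : ℕ} (hp : 1 ≤ p) {u : ℤ → Fin p → H}
    (h : ∀ t, ∃ v, u t = pushBlock (u (t - 1)) v) (t : ℤ) :
    block p (fun s => u s ⟨p - 1, by omega⟩) t = u t := by
  have key : ∀ (j : ℕ) (t : ℤ) (i : Fin p), (i : ℕ) + j = p - 1 →
      u t i = u (t - j) ⟨p - 1, by omega⟩ := by
    intro j
    induction j with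
    | zero =>
      intro t i hi
      have : i = ⟨p - 1, by omega⟩ := Fin.ext (by simpa using hi)
      simp [this]
    | succ j ih =>
      intro t i hi
      have hi1 : (i : ℕ) + 1 < p := by omega
      obtain ⟨v, hv⟩ := h t
      rw [hv, pushBlock, dif_pos hi1, ih (t - 1) ⟨i + 1, hi1⟩ (by simp only; omega)]
      congr 1
      push_cast
      ring_nf
  ext i
  obtain ⟨j, hj⟩ : ∃ j : ℕ, (i : ℕ) + j = p - 1 := ⟨p - 1 - i, by omega⟩
  rw [key j t i hj]
  exact congrArg (fun s => u s ⟨p - 1, by omega⟩) (by omega)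

theorem measurable_pushBlock {H : Type*} [MeasurableSpace H] {p : ℕ} :
    Measurable fun z : (Fin p → H) × H => pushBlock z.1 z.2 := by
  refine measurable_pi_lambda _ fun i => ?_
  simp only [pushBlock]
  split_ifs with hi
  · exact (measurable_pi_apply _).comp measurable_fst
  · exact measurable_snd

variable {Ω : Type*} [MeasurableSpace Ω] {μ : Measure Ω} {k p q : ℕ}
  {F P : Type*} [MetricSpace F] [MeasurableSpace F] {E : Type*} [MetricSpace E]

/-- The random map of the recurrence driven by the observations, as a function of the path of the
observations. -/
def pathMap (M : VolatilityModel μ k p q F P) (e : E ≃ₜ (Fin p → M.H)) (θ : P)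
    (ξ : ℤ → Fin k → ℝ) (x : E) : E :=
  e.symm (pushBlock (e x) (M.f (e x) θ fun i => ξ (-1 - (i : ℕ))))

theorem φ_eq_drivenMap (M : VolatilityModel μ k p q F P) (e : E ≃ₜ (Fin p → M.H))
    (X : ℤ → Ω → (Fin k → ℝ)) {Θ : Set P} (θ : Θ) :
    M.φ e X (θ : P) = drivenMap (fun θ : Θ => M.pathMap e (θ : P)) X θ := by
  ext t ω x
  simp only [φ, next, drivenMap, pathMap, shiftPath]
  congr 4
  ext i
  congr 2
  ring

theorem measurable_pathMap [BorelSpace F] [SecondCountableTopology F] [MeasurableSpace E]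
    [BorelSpace E] (M : VolatilityModel μ k p q F P) (e : E ≃ₜ (Fin p → M.H)) (θ : P) :
    Measurable fun z : (ℤ → Fin k → ℝ) × E => M.pathMap e θ z.1 z.2 := by
  have he : Measurable fun z : (ℤ → Fin k → ℝ) × E => e z.2 := e.measurable.comp measurable_snd
  have hξ : Measurable fun z : (ℤ → Fin k → ℝ) × E => fun i : Fin q => z.1 (-1 - (i : ℕ)) :=
    measurable_pi_lambda _ fun i => (measurable_pi_apply _).comp measurable_fst
  exact e.symm.measurable.comp (measurable_pushBlock.comp
    (he.prodMk ((M.f_measurable θ).comp (he.prodMk hξ))))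

theorem edist_le_of_lipschitz_coords {M : VolatilityModel μ k p q F P} {e : E ≃ₜ (Fin p → M.H)}
    (hp : 1 ≤ p) {K : ℝ≥0} (hK : ∀ i : Fin p, LipschitzWith K fun x : E => e x i)
    (g g' : ℤ → M.H) (t : ℤ) :
    edist (g t) (g' t) ≤ K * edist (M.state e g t) (M.state e g' t) := by
  have h := hK ⟨p - 1, by omega⟩ (M.state e g t) (M.state e g' t)
  simpa only [state, Homeomorph.apply_symm_apply, block_last hp] using h

end VolatilityModel

/-! ### Continuous invertibility -/

theorem mainTheorem6 {Ω : Type*} [MeasurableSpace Ω] (μ : Measure Ω) [IsProbabilityMeasure μ]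
    (k p q : ℕ) (hp : 1 ≤ p)
    {F : Type*} [MetricSpace F] [TopologicalSpace.SeparableSpace F] [MeasurableSpace F]
    [BorelSpace F] {P : Type*} [MetricSpace P]
    (M : VolatilityModel μ k p q F P)
    {E : Type*} [MetricSpace E] [CompleteSpace E] [MeasurableSpace E] [BorelSpace E]
    (e : E ≃ₜ (Fin p → M.H))
    (he : ∃ K : ℝ≥0, ∀ i : Fin p, LipschitzWith K fun x : E => e x i)
    (Sig : ℤ → Ω → M.D) (X : ℤ → Ω → (Fin k → ℝ)) (Θ : Set P)
    (hST : M.ST Sig X) (hCI : M.CI e X Θ) :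
    ∃ g : ℤ → Ω → Θ → M.H,
      (∀ θ : Θ, IsConvergentSRE μ (M.φ e X (θ : P)) fun t ω => M.state e (fun s => g s ω θ) t) ∧
      (∀ᵐ ω ∂μ, ∀ t : ℤ, Continuous (g t ω)) ∧
      (∀ᵐ ω ∂μ, ∀ (t : ℤ) (θ : Θ),
        M.state e (fun s => g s ω θ) t =
          M.φ e X θ t ω (M.state e (fun s => g s ω θ) (t - 1))) ∧
      ∀ θ : Θ, ∃ ε : ℝ, 0 < ε ∧ ∀ ghat : ℤ → Ω → Θ → M.H,
        (∀ᵐ ω ∂μ, Bornology.IsBounded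
          (Set.range fun θ' : Θ => M.state e (fun s => ghat s ω θ') 0)) →
        (∀ᵐ ω ∂μ, ∀ t : ℤ, 1 ≤ t → ∀ θ' : Θ,
          M.state e (fun s => ghat s ω θ') t =
            M.φ e X θ' t ω (M.state e (fun s => ghat s ω θ') (t - 1))) →
        (ExpAlmostSurely μ fun t ω =>
          ⨆ θ' ∈ Metric.closedBall θ ε, edist (ghat t ω θ') (g t ω θ')) ∧
        (ExpAlmostSurely μ fun t ω =>
          ⨆ θ' ∈ Metric.closedBall θ ε,
            edist (M.state e (fun s => ghat s ω θ') t) (M.state e (fun s => g s ω θ') t)) := by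
  obtain ⟨K, hK⟩ := he
  obtain ⟨hcomp, hpar, ⟨Λ₁, -, hΛ₁⟩, ⟨r, hr, Λ, hΛs, hΛ, hneg, hΛsup⟩, ⟨y, hy⟩⟩ := hCI
  have hX := hST.stationary_ergodic
  have : SecondCountableTopology F := UniformSpace.secondCountable_of_separable F
  have : SecondCountableTopology E := e.isInducing.secondCountableTopology
  have : CompactSpace Θ := isCompact_iff_compactSpace.1 hcomp
  have : Nonempty E := ⟨y⟩
  set G : Θ → (ℤ → Fin k → ℝ) → E → E := fun θ => M.pathMap e (θ : P) with hGdef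
  have hG : ∀ θ, Measurable fun z : (ℤ → Fin k → ℝ) × E => G θ z.1 z.2 := fun θ =>
    M.measurable_pathMap e θ
  have hφ : ∀ θ : Θ, M.φ e X (θ : P) = drivenMap G X θ := fun θ => M.φ_eq_drivenMap e X θ
  simp only [hφ] at hpar hΛ₁ hΛ hy ⊢
  have hreg : ∀ᵐ ω ∂μ, RegularAt (drivenMap G X) ω := by
    filter_upwards [ae_all_iff.2 hpar, ae_all_iff.2 hΛ₁] with ω h1 h2
    exact regularAt_of_satisfiesCL h1 fun t => ⟨_, h2 t⟩
  have hcontr : ∀ θ, ∃ ε : ℝ, 0 < ε ∧ ∃ δ : ℝ, 0 < δ ∧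
      ∀ᵐ ω ∂μ, IsContracting (drivenMap G X) (Metric.closedBall θ ε) y δ ω := fun θ =>
    exists_ae_isContracting hX hG hreg hr
      (fun θ => (measurable_pi_apply θ).comp (hΛs.1 0)) (hΛ 0) hΛsup hy (hneg θ)
  have hloc := ae_isLocallyContracting hcontr
  -- the limit of the backward iterations
  set sol : Θ → (ℤ → Fin k → ℝ) → E := fun θ ξ =>
    limUnder atTop fun n => pathIter (G θ) n ξ y with hsol
  have hsolm : ∀ θ, Measurable (sol θ) := fun θ =>
    (StronglyMeasurable.limUnder fun n => ((measurable_pathIter (hG θ) n).comp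
      (measurable_id.prodMk measurable_const)).stronglyMeasurable).measurable
  have hlim : ∀ᵐ ω ∂μ, ∀ (θ : Θ) (t : ℤ),
      Tendsto (fun n => backIter (drivenMap G X θ) ω n t y) atTop
        (𝓝 (sol θ (shiftPath X t ω))) := by
    filter_upwards [hloc] with ω hω θ t
    have h := tendsto_nhds_limUnder (hω.exists_tendsto θ t)
    simpa only [backIter_drivenMap] using h
  have hrec : ∀ᵐ ω ∂μ, ∀ (θ : Θ) (t : ℤ), sol θ (shiftPath X t ω) =
      drivenMap G X θ t ω (sol θ (shiftPath X (t - 1) ω)) := by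
    filter_upwards [hlim, hreg] with ω h1 h2 θ t
    exact eq_of_tendsto_backIter (Y := fun t => sol θ (shiftPath X t ω)) (h1 θ)
      (fun t => by obtain ⟨C, hC, -⟩ := h2 t; exact (hC θ).continuous) t
  set g : ℤ → Ω → Θ → M.H := fun t ω θ => e (sol θ (shiftPath X t ω)) ⟨p - 1, by omega⟩ with hg
  have hstate : ∀ᵐ ω ∂μ, ∀ (θ : Θ) (t : ℤ),
      M.state e (fun s => g s ω θ) t = sol θ (shiftPath X t ω) := by
    filter_upwards [hrec] with ω hω θ t
    rw [VolatilityModel.state, Homeomorph.symm_apply_eq]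
    refine VolatilityModel.block_eq_of_pushBlock hp (u := fun t => e (sol θ (shiftPath X t ω)))
      (fun t => ?_) t
    exact ⟨_, (congrArg e (hω θ t)).trans (e.apply_symm_apply _)⟩
  have hgrec : ∀ᵐ ω ∂μ, ∀ (t : ℤ) (θ : Θ), M.state e (fun s => g s ω θ) t =
      drivenMap G X θ t ω (M.state e (fun s => g s ω θ) (t - 1)) := by
    filter_upwards [hstate, hrec] with ω h1 h2 t θ
    rw [h1, h1]
    exact h2 θ t
  have hsolc : ∀ᵐ ω ∂μ, ∀ t : ℤ, Continuous fun θ => sol θ (shiftPath X t ω) := by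
    filter_upwards [hlim, hloc, hreg] with ω h1 h2 h3 t
    exact h2.continuous_limit h3 fun θ => h1 θ t
  refine ⟨g, fun θ => ?_, ?_, hgrec, fun θ => ?_⟩
  · obtain ⟨ε, hε, δ, hδ, hc⟩ := hcontr θ
    refine isConvergentSRE_of_isContracting (Metric.mem_closedBall_self hε.le) hδ hc ?_ ?_ ?_
    · filter_upwards [hreg] with ω hω t
      obtain ⟨C, hC, -⟩ := hω t
      exact (hC θ).continuous
    -- The block agrees with `sol` only almost surely. Written as a functional of the path, it
    -- equals the process everywhere, so stationarity and ergodicity transfer exactly.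
    · have hV : Measurable fun ξ : ℤ → Fin k → ℝ => e.symm fun i : Fin p =>
          e (sol θ fun s => ξ (s - p + 1 + (i : ℕ))) ⟨p - 1, by omega⟩ := by
        refine e.symm.measurable.comp (measurable_pi_lambda _ fun i => ?_)
        refine (measurable_pi_apply _).comp (e.measurable.comp ((hsolm θ).comp ?_))
        exact measurable_pi_lambda _ fun s => measurable_pi_apply _
      convert hX.comp_shiftPath hV using 3 with t ω
      refine congrArg e.symm (funext fun i => ?_)
      have hs : shiftPath X (t - p + 1 + (i : ℕ)) ω =
          fun s => shiftPath X t ω (s - p + 1 + (i : ℕ)) :=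
        funext fun s => congrArg (fun a => X a ω) (by ring)
      simp only [VolatilityModel.block, hg, hs]
    · filter_upwards [hlim, hstate] with ω h1 h2 t
      rw [h2]
      exact h1 θ t
  · filter_upwards [hsolc] with ω hω t
    exact (continuous_apply _).comp (e.continuous.comp (hω t))
  · obtain ⟨ε, hε, δ, hδ, hc⟩ := hcontr θ
    refine ⟨ε, hε, fun ghat hbdd hghat => ?_⟩
    have hexp : ExpAlmostSurely μ fun t ω => ⨆ θ' ∈ Metric.closedBall θ ε,
        edist (M.state e (fun s => ghat s ω θ') t) (M.state e (fun s => g s ω θ') t) := by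
      refine expAlmostSurely_of_eventually_le hδ ?_
      filter_upwards [hbdd, hghat, hgrec, hstate, hsolc, hc] with ω h1 h2 h3 h4 h5 h6
      refine h6.forward _ subset_rfl (fun t θ' => M.state e (fun s => ghat s ω θ') t)
        (fun t θ' => M.state e (fun s => g s ω θ') t) (fun t ht θ' _ => h2 t ht θ')
        (fun t _ θ' _ => h3 t θ') ?_
      -- The initial distance is finite uniformly in the parameter: the initial values are bounded,
      -- and the limit is continuous on a compact set.
      obtain ⟨C, hC⟩ := Metric.isBounded_iff.1 (h1.union (isCompact_range (h5 0)).isBounded)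
      refine (iSup₂_le fun θ' _ => ?_).trans_lt (ENNReal.ofReal_lt_top (r := C))
      rw [h4, edist_dist]
      exact ENNReal.ofReal_le_ofReal
        (hC (Or.inl (Set.mem_range_self θ')) (Or.inr (Set.mem_range_self θ')))
    refine ⟨hexp.of_le_const_mul K fun t ω => iSup₂_le fun θ' hθ' => ?_, hexp⟩
    refine (VolatilityModel.edist_le_of_lipschitz_coords hp hK (fun s => ghat s ω θ')
      (fun s => g s ω θ') t).trans ?_
    exact mul_le_mul_right (le_iSup₂ (f := fun θ' (_ : θ' ∈ Metric.closedBall θ ε) =>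
      edist (M.state e (fun s => ghat s ω θ') t) (M.state e (fun s => g s ω θ') t)) θ' hθ') _
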